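/- **Definitions.** A \emph{Reuleaux polygon} of width $1$ with $2N+1$ arcs is a planar convex body $\Omega$ of constant width $1$ with distinct vertices $P_k$, $k\in\mathbb Z/(2N+1)$, and angles $\alpha_k<\beta_k$ such that $P_{k+1}=P_k+(\cos\alpha_k,\sin\alpha_k)$, $P_{k-1}=P_k+(\cos\beta_k,\sin\beta_k)$, and $\partial\Omega$ is the union of the arcs $\Gamma_k=\{P_k+(\cos t,\sin t):\alpha_k\le t\le\beta_k\}$. Let $\Omega$ have inradius $r$, with its incircle $\{|x|=r\}$ centred at the origin; the \emph{outer circle} is $\{|x|=1-r\}$. A \emph{Blaschke deformation} of $\Omega$ with parameter $\varepsilon\in\mathbb R$ acting on $P_k$ replaces $\Omega$ by a Reuleaux polygon $\Omega'$ with $2N+1$ arcs and vertices $P'_j$ such that $P'_k=P_{k-1}+(\cos(\alpha_{k-1}+\varepsilon),\sin(\alpha_{k-1}+\varepsilon))$ and $P'_j=P_j$ for all $j\notin\{k,k+1\}$. It is \emph{admissible} if $\Omega'$ again has inradius $r$ with the incircle centred at the origin. The polygon $\Omega$ is \emph{rigid} if for some $\delta>0$ no admissible Blaschke deformation with $|\varepsilon|<\delta$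 strictly decreases the area. (In particular $\Omega$ is rigid if no admissible Blaschke deformation of any size decreases the area.) An arc $\Gamma_k$ is \emph{extremal} if it is tangent to the incircle and its endpoints $P_{k-1},P_{k+1}$ both lie on the outer circle. Three arcs $\Gamma_{k-1},\Gamma_k,\Gamma_{k+1}$ form a \emph{cluster} if $\Gamma_{k-1}$ and $\Gamma_{k+1}$ are tangent to the incircle, their common point $P_k$ satisfies $r<|P_k|<1-r$, and their other endpoints $P_{k-2}$ and $P_{k+2}$ lie on the outer circle. **Proposition 3.4.** Let $\Omega$ be a rigid Reuleaux polygon of width $1$ and inradius $r$, with incircle centred at the origin. Then the boundary of $\Omega$ is made of a finite number (possibly zero) of clusters and of extremal arcs: the arcs $\Gamma_k$ can be partitioned into pairwise disjoint triples, each forming a cluster, and single arcs, each of which is extremal. -/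

import Mathlib

open Metric MeasureTheory

/-- The unit vector `(cos t, sin t)` of the Euclidean plane, which is identified with `ℂ`. -/
noncomputable def unitVec (t : ℝ) : ℂ := Complex.exp (t * Complex.I)

/-- The width of a (compact, nonempty) plane set in the unit direction `ν`: the distance of the
two lines orthogonal to `ν` that support the set. -/
noncomputable def widthIn (K : Set ℂ) (ν : ℂ) : ℝ :=
  sSup ((fun x : ℂ => inner ℝ ν x) '' K) - sInf ((fun x : ℂ => inner ℝ ν x) '' K)

/-- A plane convex body of constant width `1`. -/
structure IsConstantWidthOne (K : Set ℂ) : Prop where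
  isCompact : IsCompact K
  convex : Convex ℝ K
  interior_nonempty : (interior K).Nonempty
  width_eq : ∀ ν : ℂ, ‖ν‖ = 1 → widthIn K ν = 1

/-- `r` is the inradius of `K`: the largest radius of an open disk contained in `K`. -/
def HasInradius (K : Set ℂ) (r : ℝ) : Prop :=
  IsGreatest {ρ : ℝ | ∃ c : ℂ, ball c ρ ⊆ K} r

/-- `K` has inradius `r`, with an incircle centred at the origin. For a body of constant width `1`
this says that its minimal annulus is the one bounded by the circles of radius `r` and `1 - r`
centred at the origin. -/
def HasCentredIncircle (K : Set ℂ) (r : ℝ) : Prop :=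
  HasInradius K r ∧ ball 0 r ⊆ K

/-- The circular arc of radius `1` and centre `p`, between the angles `a` and `b`. -/
def unitArc (p : ℂ) (a b : ℝ) : Set ℂ := (fun t : ℝ => p + unitVec t) '' Set.Icc a b

/-- A Reuleaux polygon of width `1` with `2 * N + 1` arcs: a convex body of constant width `1`
whose boundary is the union of the arcs `Γ k = {P k + (cos t, sin t) : α k ≤ t ≤ β k}` of radius
`1`, centred at the vertices `P k` of the body and with end points `P (k + 1)` (at `t = α k`) and
`P (k - 1)` (at `t = β k`). The labels are cyclic and every vertex carries one label only. -/
structure ReuleauxPolygon (N : ℕ) where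
  body : Set ℂ
  vertex : ZMod (2 * N + 1) → ℂ
  α : ZMod (2 * N + 1) → ℝ
  β : ZMod (2 * N + 1) → ℝ
  constantWidth : IsConstantWidthOne body
  vertex_injective : Function.Injective vertex
  α_lt_β : ∀ k, α k < β k
  vertex_succ : ∀ k, vertex (k + 1) = vertex k + unitVec (α k)
  vertex_pred : ∀ k, vertex (k - 1) = vertex k + unitVec (β k)
  frontier_eq : frontier body = ⋃ k, unitArc (vertex k) (α k) (β k)

namespace ReuleauxPolygon

variable {N : ℕ}

/-- `Q'` is obtained from `Q` by the Blaschke deformation with parameter `ε` acting on the vertex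
`P k`: this vertex moves by the angle `ε` on the circle that carries the arc `Γ (k - 1)`
(so `α (k - 1)` becomes `α (k - 1) + ε`), the vertex `P (k + 1)` moves accordingly, all other
vertices are kept, and the result is again a Reuleaux polygon. -/
def IsBlaschkeDeformation (Q Q' : ReuleauxPolygon N) (k : ZMod (2 * N + 1)) (ε : ℝ) : Prop :=
  Q'.vertex k = Q.vertex (k - 1) + unitVec (Q.α (k - 1) + ε) ∧
    ∀ j, j ≠ k → j ≠ k + 1 → Q'.vertex j = Q.vertex j

/-- No Blaschke deformation with parameter of absolute value less than `δ` decreases the area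
while keeping the inradius `r` and the incircle. -/
def IsRigidUpTo (Q : ReuleauxPolygon N) (r δ : ℝ) : Prop :=
  ∀ (k : ZMod (2 * N + 1)) (ε : ℝ) (Q' : ReuleauxPolygon N), |ε| < δ →
    Q.IsBlaschkeDeformation Q' k ε → HasCentredIncircle Q'.body r → ¬ volume Q'.body < volume Q.body

/-- A polygon is rigid if no small Blaschke deformation decreases the area while keeping the
inradius `r` and the incircle. This is implied by the absence of such deformations of arbitrary size, that
is, by `Q.IsRigidUpTo r δ` for all `δ`. -/
def IsRigid (Q : ReuleauxPolygon N) (r : ℝ) : Prop :=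
  ∃ δ : ℝ, 0 < δ ∧ Q.IsRigidUpTo r δ

/-- The arc `Γ k` is tangent to the circle of radius `r` centred at the origin: they have a common
point, with the same outer normal. -/
def IsTangentArc (Q : ReuleauxPolygon N) (r : ℝ) (k : ZMod (2 * N + 1)) : Prop :=
  ∃ t ∈ Set.Icc (Q.α k) (Q.β k), Q.vertex k + unitVec t = r * unitVec t

/-- The arc `Γ k` is extremal: it is tangent to the incircle and both end points lie on the outer
circle. -/
def IsExtremalArc (Q : ReuleauxPolygon N) (r : ℝ) (k : ZMod (2 * N + 1)) : Prop :=
  Q.IsTangentArc r k ∧ ‖Q.vertex (k + 1)‖ = 1 - r ∧ ‖Q.vertex (k - 1)‖ = 1 - r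

/-- The arcs `Γ (k - 1)`, `Γ k`, `Γ (k + 1)` form a cluster: the first and the last are tangent to
the incircle, their common end point `P k` lies in the interior of the annulus, and their other
end points `P (k - 2)` and `P (k + 2)` lie on the outer circle. -/
def IsCluster (Q : ReuleauxPolygon N) (r : ℝ) (k : ZMod (2 * N + 1)) : Prop :=
  Q.IsTangentArc r (k - 1) ∧ Q.IsTangentArc r (k + 1) ∧
    r < ‖Q.vertex k‖ ∧ ‖Q.vertex k‖ < 1 - r ∧
    ‖Q.vertex (k - 2)‖ = 1 - r ∧ ‖Q.vertex (k + 2)‖ = 1 - r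

end ReuleauxPolygon

/-- The three labels `k - 1`, `k`, `k + 1`. -/
def labelTriple {n : ℕ} (k : ZMod n) : Finset (ZMod n) := {k - 1, k, k + 1}

/-!
The body of a Reuleaux polygon is the intersection of the unit disks centred at its vertices. Hence
its incircle is centred at the origin if and only if all vertices lie in the disk of radius `1 - r`
and those on the outer circle have the origin in their convex hull. A Blaschke deformation is the
motion of a linkage of three unit bars. The area of the body is `π / 2` minus the sum of the
determinants of consecutive vertices; it decreases strictly in the direction of this motion in which
the larger of the angles at the two moving vertices grows.

If two consecutive vertices were off the outer circle, both could move freely, and the area could be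
decreased. Suppose next that `P k` is on the outer circle and `P (k - 1)`, `P (k + 1)` are not. Then
`P k` lies in the cone spanned by `P (k - 2)` and `P (k + 2)`, which are on the outer circle, so the
incircle is still determined without `P k`; moreover the arc `Γ k` is shorter than one of its
neighbours, and moving `P k` into the outer disk, with `P (k + 1)` or `P (k - 1)` as the second
moving vertex, decreases the area. So in a rigid polygon a vertex off the outer circle has four
neighbours on it, two on each side: it is the middle of a cluster, and the arcs outside of the
clusters are extremal.
-/

open scoped InnerProductSpace

/-! ### Normed and inner product spaces -/

section NormedSpace

variable {E : Type*} [NormedAddCommGroup E] [NormedSpace ℝ E]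

theorem dist_add_le_of_closedBall_subset [Nontrivial E] {c x : E} {ρ R : ℝ} (hρ : 0 ≤ ρ)
    (h : closedBall c ρ ⊆ closedBall x R) : dist c x + ρ ≤ R := by
  obtain ⟨u, hu, hcx⟩ : ∃ u : E, ‖u‖ = 1 ∧ c - x = ‖c - x‖ • u := by
    rcases eq_or_ne (c - x) 0 with h0 | h0
    · obtain ⟨u, hu⟩ := exists_norm_eq E zero_le_one
      exact ⟨u, hu, by simp [h0]⟩
    · exact ⟨‖c - x‖⁻¹ • (c - x), norm_smul_inv_norm h0, by simp [smul_smul, h0]⟩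
  have hmem : c + ρ • u ∈ closedBall x R := h (by simp [norm_smul, hu, abs_of_nonneg hρ])
  have hsum : c + ρ • u - x = (‖c - x‖ + ρ) • u := by
    rw [add_smul, ← hcx]; abel
  rwa [mem_closedBall, dist_eq_norm, hsum, norm_smul, hu, mul_one, Real.norm_eq_abs,
    abs_of_nonneg (by positivity), ← dist_eq_norm] at hmem

theorem eq_of_frontier_eq {K L : Set E} (hK : IsClosed K) (hKint : (interior K).Nonempty)
    (hL : Convex ℝ L) (hKL : K ⊆ L) (hfr : frontier L = frontier K) : K = L := by
  have hcover : interior L ⊆ interior K ∪ Kᶜ := by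
    intro y hy
    by_contra hyK
    simp only [Set.mem_union, Set.mem_compl_iff, not_or, not_not] at hyK
    have hyL : y ∈ frontier L := hfr ▸ ⟨subset_closure hyK.2, hyK.1⟩
    exact hyL.2 hy
  have hint : interior L ⊆ interior K :=
    hL.interior.isPreconnected.subset_left_of_subset_union isOpen_interior hK.isOpen_compl
      (disjoint_compl_right.mono_left interior_subset) hcover
      (hKint.mono (Set.subset_inter (interior_mono hKL) subset_rfl))
  refine hKL.antisymm (subset_closure.trans ?_)
  rw [← hL.closure_interior_eq_closure_of_nonempty_interior (hKint.mono (interior_mono hKL))]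
  exact closure_minimal (hint.trans interior_subset) hK

end NormedSpace

section InnerProductSpace

variable {E : Type*} [NormedAddCommGroup E] [InnerProductSpace ℝ E]

theorem norm_sub_le_one_iff {u x : E} (hu : ‖u‖ = 1) :
    ‖x - u‖ ≤ 1 ↔ ‖x‖ ^ 2 / 2 ≤ ⟪u, x⟫_ℝ := by
  rw [← sq_le_one_iff₀ (norm_nonneg _), norm_sub_sq_real, hu, real_inner_comm]
  constructor <;> intro h <;> linarith

theorem eq_smul_of_le_inner {u x : E} {r : ℝ} (hu : ‖u‖ = 1) (hx : ‖x‖ ≤ r)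
    (h : r ≤ ⟪u, x⟫_ℝ) : x = r • u := by
  have hr : ‖x‖ ^ 2 ≤ r * ⟪u, x⟫_ℝ := by nlinarith [norm_nonneg x]
  have hsq : ‖x - r • u‖ ^ 2 ≤ 0 := by
    rw [norm_sub_sq_real, real_inner_smul_right, norm_smul, hu, real_inner_comm, mul_one,
      Real.norm_eq_abs, sq_abs]
    nlinarith [norm_nonneg x]
  exact sub_eq_zero.mp (norm_eq_zero.mp (pow_eq_zero_iff two_ne_zero |>.mp
    (hsq.antisymm (sq_nonneg _))))

theorem zero_mem_convexHull_iff [CompleteSpace E] {S : Set E} (hS : S.Finite) :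
    (0 : E) ∈ convexHull ℝ S ↔ ∀ v : E, ∃ x ∈ S, ⟪v, x⟫_ℝ ≤ 0 := by
  refine ⟨fun h v => ?_, fun h => ?_⟩
  · by_contra! hpos
    have hhalf : convexHull ℝ S ⊆ {x | 0 < ⟪v, x⟫_ℝ} :=
      convexHull_min hpos (convex_halfSpace_gt (innerₗ E v).isLinear 0)
    simpa using hhalf h
  · by_contra h0
    obtain ⟨f, u, hu, hf⟩ := geometric_hahn_banach_point_closed (convex_convexHull ℝ S)
      (hS.isClosed_convexHull ℝ) h0
    obtain ⟨x, hx, hle⟩ := h ((InnerProductSpace.toDual ℝ E).symm f)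
    rw [InnerProductSpace.toDual_symm_apply] at hle
    rw [map_zero] at hu
    exact absurd (hf x (subset_convexHull ℝ S hx)) (by linarith)

/-- The ball of radius `R` centred at `0` is the smallest ball containing the `P j` if and only if
those of them that lie on its boundary surround `0`. -/
theorem zero_mem_convexHull_iff_exists_le_norm_sub [CompleteSpace E] {ι : Type*} [Finite ι]
    {P : ι → E} {R : ℝ} (hP : ∀ j, ‖P j‖ ≤ R) :
    (0 : E) ∈ convexHull ℝ (P '' {j | ‖P j‖ = R}) ↔ ∀ c, ∃ j, R ≤ ‖P j - c‖ := by
  rw [zero_mem_convexHull_iff (Set.toFinite _)]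
  refine ⟨fun h c => ?_, fun h v => ?_⟩
  · obtain ⟨_, ⟨j, hj, rfl⟩, hle⟩ := h c
    refine ⟨j, ?_⟩
    rw [← hj.out, ← sq_le_sq₀ (norm_nonneg _) (norm_nonneg _), norm_sub_sq_real, real_inner_comm]
    nlinarith [sq_nonneg ‖c‖]
  · by_contra! hpos
    have hsmall : ∀ᶠ δ : ℝ in nhdsWithin 0 (Set.Ioi 0), ∀ j, ‖P j - δ • v‖ < R := by
      refine Filter.eventually_all.mpr fun j => ?_
      rcases (hP j).lt_or_eq with hj | hj
      · have hcont : ContinuousAt (fun δ : ℝ => ‖P j - δ • v‖) 0 := by fun_prop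
        exact (hcont.eventually_lt_const (by simpa using hj)).filter_mono nhdsWithin_le_nhds
      · have hcont : ContinuousAt (fun δ : ℝ => δ * ‖v‖ ^ 2 - 2 * ⟪v, P j⟫_ℝ) 0 := by fun_prop
        have hneg := hcont.eventually_lt_const (u := 0) (by simpa using hpos _ ⟨j, hj, rfl⟩)
        filter_upwards [hneg.filter_mono nhdsWithin_le_nhds, self_mem_nhdsWithin] with δ hδ hδ0
        rw [← hj, ← sq_lt_sq₀ (norm_nonneg _) (norm_nonneg _), norm_sub_sq_real, norm_smul,
          inner_smul_right, real_inner_comm, mul_pow, Real.norm_eq_abs, sq_abs]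
        nlinarith [mul_neg_of_pos_of_neg (Set.mem_Ioi.mp hδ0) hδ]
    obtain ⟨δ, hδ⟩ := hsmall.exists
    obtain ⟨j, hj⟩ := h (δ • v)
    exact absurd (hδ j) hj.not_gt

end InnerProductSpace

/-! ### Plane vectors -/

/-- The determinant of two plane vectors, that is, the area form of the plane, as a continuous
bilinear form. -/
noncomputable def areaForm : ℂ →L[ℝ] ℂ →L[ℝ] ℝ :=
  haveI := Complex.finrank_real_complex_fact
  Complex.orientation.areaForm'

theorem areaForm_apply (z w : ℂ) : areaForm z w = z.re * w.im - z.im * w.re := by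
  have := Complex.finrank_real_complex_fact
  have h : areaForm z w = Complex.orientation.areaForm z w :=
    Complex.orientation.areaForm'_apply z ▸ rfl
  rw [h, Complex.areaForm, Complex.mul_im, Complex.conj_re, Complex.conj_im]
  ring

theorem inner_eq_re_add_im (z w : ℂ) : ⟪z, w⟫_ℝ = z.re * w.re + z.im * w.im := by
  rw [Complex.inner, Complex.mul_re, Complex.conj_re, Complex.conj_im]
  ring

theorem areaForm_self (z : ℂ) : areaForm z z = 0 := by
  rw [areaForm_apply]; ring

theorem areaForm_swap (z w : ℂ) : areaForm z w = -areaForm w z := by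
  rw [areaForm_apply, areaForm_apply]; ring

@[simp] theorem unitVec_re (t : ℝ) : (unitVec t).re = Real.cos t := Complex.exp_ofReal_mul_I_re t

@[simp] theorem unitVec_im (t : ℝ) : (unitVec t).im = Real.sin t := Complex.exp_ofReal_mul_I_im t

@[simp] theorem norm_unitVec (t : ℝ) : ‖unitVec t‖ = 1 := Complex.norm_exp_ofReal_mul_I t

theorem inner_unitVec_self (t : ℝ) : ⟪unitVec t, unitVec t⟫_ℝ = 1 := by
  rw [real_inner_self_eq_norm_sq, norm_unitVec, one_pow]

theorem unitVec_add (s t : ℝ) : unitVec (s + t) = unitVec s * unitVec t := by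
  rw [unitVec, unitVec, unitVec, ← Complex.exp_add, ← add_mul, Complex.ofReal_add]

theorem unitVec_add_pi (t : ℝ) : unitVec (t + Real.pi) = -unitVec t := by
  apply Complex.ext <;> simp

theorem unitVec_sub_pi (t : ℝ) : unitVec (t - Real.pi) = -unitVec t := by
  apply Complex.ext <;> simp

theorem unitVec_arg {z : ℂ} (hz : ‖z‖ = 1) : unitVec z.arg = z := by
  simpa [unitVec, hz] using Complex.norm_mul_exp_arg_mul_I z

theorem exists_unitVec_eq {z : ℂ} (hz : ‖z‖ = 1) : ∃ t, unitVec t = z :=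
  ⟨z.arg, unitVec_arg hz⟩

theorem unitVec_sub_int_mul_pi (s : ℝ) (n : ℤ) :
    unitVec (s - n * Real.pi) = unitVec s ∨ unitVec (s - n * Real.pi) = -unitVec s := by
  rcases n.even_or_odd with h | h
  · left
    apply Complex.ext <;> simp [Real.cos_sub_int_mul_pi, Real.sin_sub_int_mul_pi, h.neg_one_zpow]
  · right
    apply Complex.ext <;> simp [Real.cos_sub_int_mul_pi, Real.sin_sub_int_mul_pi, h.neg_one_zpow]

theorem inner_unitVec (s t : ℝ) : ⟪unitVec s, unitVec t⟫_ℝ = Real.cos (s - t) := by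
  simp only [inner_eq_re_add_im, unitVec_re, unitVec_im, Real.cos_sub]

theorem areaForm_unitVec (s t : ℝ) : areaForm (unitVec s) (unitVec t) = Real.sin (t - s) := by
  rw [areaForm_apply, Real.sin_sub]
  simp only [unitVec_re, unitVec_im]
  ring

theorem unitVec_ne_of_lt_of_lt_add_pi {a b : ℝ} (hab : a < b) (hba : b < a + Real.pi) :
    unitVec a ≠ unitVec b := by
  intro h
  have hsin : 0 < Real.sin (b - a) := Real.sin_pos_of_pos_of_lt_pi (by linarith) (by linarith)
  rw [← areaForm_unitVec, h, areaForm_self] at hsin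
  exact hsin.false

theorem sin_sub_smul_unitVec (a b t : ℝ) : Real.sin (b - a) • unitVec t =
    Real.sin (b - t) • unitVec a + Real.sin (t - a) • unitVec b := by
  apply Complex.ext
  · simp only [Complex.add_re, Complex.real_smul, Complex.re_ofReal_mul, unitVec_re, Real.sin_sub]
    ring
  · simp only [Complex.add_im, Complex.real_smul, Complex.im_ofReal_mul, unitVec_im, Real.sin_sub]
    ring

theorem le_inner_unitVec_of_mem_Icc {a b t c : ℝ} {w : ℂ} (hba : b < a + Real.pi)
    (ht : t ∈ Set.Icc a b) (hc : 0 ≤ c) (ha : c ≤ ⟪unitVec a, w⟫_ℝ)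
    (hb : c ≤ ⟪unitVec b, w⟫_ℝ) : c ≤ ⟪unitVec t, w⟫_ℝ := by
  obtain ⟨hat, htb⟩ := ht
  rcases (hat.trans htb).eq_or_lt with hab | hab
  · rwa [← hat.antisymm (hab ▸ htb)]
  have hsin : 0 < Real.sin (b - a) := Real.sin_pos_of_pos_of_lt_pi (by linarith) (by linarith)
  have hbt : 0 ≤ Real.sin (b - t) := Real.sin_nonneg_of_nonneg_of_le_pi (by linarith) (by linarith)
  have hta : 0 ≤ Real.sin (t - a) := Real.sin_nonneg_of_nonneg_of_le_pi (by linarith) (by linarith)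
  have hsub : Real.sin (b - a) ≤ Real.sin (b - t) + Real.sin (t - a) := by
    rw [← sub_add_sub_cancel b t a, Real.sin_add]
    nlinarith [Real.cos_le_one (b - t), Real.cos_le_one (t - a)]
  have hcomb : Real.sin (b - a) * ⟪unitVec t, w⟫_ℝ =
      Real.sin (b - t) * ⟪unitVec a, w⟫_ℝ + Real.sin (t - a) * ⟪unitVec b, w⟫_ℝ := by
    simpa only [inner_add_left, real_inner_smul_left] using
      congrArg (fun z => ⟪z, w⟫_ℝ) (sin_sub_smul_unitVec a b t)
  refine le_of_mul_le_mul_left ?_ hsin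
  rw [hcomb]
  linarith [mul_le_mul_of_nonneg_left ha hbt, mul_le_mul_of_nonneg_left hb hta,
    mul_le_mul_of_nonneg_right hsub hc]

theorem norm_sub_unitVec_le_one_of_mem_Icc {a b t : ℝ} {w : ℂ} (hba : b < a + Real.pi)
    (ht : t ∈ Set.Icc a b) (ha : ‖w - unitVec a‖ ≤ 1) (hb : ‖w - unitVec b‖ ≤ 1) :
    ‖w - unitVec t‖ ≤ 1 := by
  rw [norm_sub_le_one_iff (norm_unitVec _)] at *
  exact le_inner_unitVec_of_mem_Icc hba ht (by positivity) ha hb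

/-! ### Intersections of unit disks -/

/-- The intersection of the closed unit disks centred at the points `P j`. -/
def diskInter {ι : Type*} (P : ι → ℂ) : Set ℂ := ⋂ j, closedBall (P j) 1

section DiskInter

variable {ι : Type*} {P : ι → ℂ}

theorem mem_diskInter {x : ℂ} : x ∈ diskInter P ↔ ∀ j, ‖x - P j‖ ≤ 1 := by
  simp [diskInter, dist_eq_norm]

theorem convex_diskInter (P : ι → ℂ) : Convex ℝ (diskInter P) :=
  convex_iInter fun _ => convex_closedBall _ _

theorem isClosed_diskInter (P : ι → ℂ) : IsClosed (diskInter P) :=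
  isClosed_iInter fun _ => isClosed_closedBall

theorem isCompact_diskInter [Nonempty ι] (P : ι → ℂ) : IsCompact (diskInter P) :=
  (isCompact_closedBall (P (Classical.arbitrary ι)) 1).of_isClosed_subset
    (isClosed_diskInter P) (Set.iInter_subset _ _)

theorem mem_frontier_diskInter [Finite ι] {x : ℂ} :
    x ∈ frontier (diskInter P) ↔ x ∈ diskInter P ∧ ∃ j, ‖x - P j‖ = 1 := by
  have hint : interior (diskInter P) = ⋂ j, ball (P j) 1 := by
    simp only [diskInter, interior_iInter_of_finite, interior_closedBall _ one_ne_zero]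
  rw [(isClosed_diskInter P).frontier_eq, hint, Set.mem_sdiff]
  refine and_congr_right fun hx => ?_
  simp only [Set.mem_iInter, not_forall, mem_ball, dist_eq_norm, not_lt]
  exact exists_congr fun j => (mem_diskInter.mp hx j).ge_iff_eq

theorem eq_add_unitVec_of_one_le_inner {x : ℂ} (hx : x ∈ diskInter P) {j : ι} {t : ℝ}
    (h : 1 ≤ ⟪unitVec t, x - P j⟫_ℝ) : x = P j + unitVec t :=
  eq_add_of_sub_eq' <| by
    simpa using eq_smul_of_le_inner (norm_unitVec t) (mem_diskInter.mp hx j) h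

theorem ball_subset_diskInter_iff {c : ℂ} {ρ : ℝ} (hρ : 0 < ρ) :
    ball c ρ ⊆ diskInter P ↔ ∀ j, ‖P j - c‖ ≤ 1 - ρ := by
  refine ⟨fun h j => ?_, fun h x hx => mem_diskInter.mpr fun j => ?_⟩
  · have hsub : closedBall c ρ ⊆ closedBall (P j) 1 := by
      rw [← closure_ball c hρ.ne']
      exact closure_minimal (h.trans (Set.iInter_subset _ j)) isClosed_closedBall
    have := dist_add_le_of_closedBall_subset hρ.le hsub
    rw [dist_comm, dist_eq_norm] at this
    linarith
  · rw [mem_ball, dist_eq_norm] at hx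
    linarith [norm_sub_le_norm_sub_add_norm_sub x c (P j), norm_sub_rev c (P j), h j]

theorem hasCentredIncircle_diskInter_iff [Finite ι] [Nonempty ι] {r : ℝ} (hr : 0 < r) :
    HasCentredIncircle (diskInter P) r ↔
      (∀ j, ‖P j‖ ≤ 1 - r) ∧ (0 : ℂ) ∈ convexHull ℝ (P '' {j | ‖P j‖ = 1 - r}) := by
  rw [HasCentredIncircle, ball_subset_diskInter_iff hr, and_comm]
  simp only [sub_zero]
  refine and_congr_right fun hP => ?_
  rw [zero_mem_convexHull_iff_exists_le_norm_sub hP]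
  refine ⟨fun h c => ?_, fun h => ⟨⟨0, ?_⟩, ?_⟩⟩
  · by_contra! hlt
    obtain ⟨j, hj⟩ := Finite.exists_max fun j => ‖P j - c‖
    have hball : ball c (1 - ‖P j - c‖) ⊆ diskInter P :=
      (ball_subset_diskInter_iff (by linarith [hlt j])).mpr fun i => by linarith [hj i]
    linarith [h.2 ⟨c, hball⟩, hlt j]
  · exact (ball_subset_diskInter_iff hr).mpr (by simpa using hP)
  · rintro ρ ⟨c, hc⟩
    rcases le_or_gt ρ 0 with hρ | hρ
    · exact hρ.trans hr.le
    · obtain ⟨j, hj⟩ := h c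
      linarith [(ball_subset_diskInter_iff hρ).mp hc j]

end DiskInter

/-! ### Unit stars -/

/-- A closed star of unit segments with vertices at mutual distance at most `1`: the
combinatorial data of a Reuleaux polygon. -/
structure IsUnitStar {N : ℕ} (P : ZMod (2 * N + 1) → ℂ) (α β : ZMod (2 * N + 1) → ℝ) : Prop where
  lt : ∀ k, α k < β k
  lt_add_pi : ∀ k, β k < α k + Real.pi
  succ : ∀ k, P (k + 1) = P k + unitVec (α k)
  pred : ∀ k, P (k - 1) = P k + unitVec (β k)
  norm_sub_le : ∀ i j, ‖P i - P j‖ ≤ 1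

/-- The angle swept by the first `m` arcs from the label `k` on. -/
def sweep {n : ℕ} (α β : ZMod n → ℝ) (k : ZMod n) (m : ℕ) : ℝ :=
  ∑ i ∈ Finset.range m, (β (k + i) - α (k + i))

theorem sweep_zero {n : ℕ} (α β : ZMod n → ℝ) (k : ZMod n) : sweep α β k 0 = 0 :=
  Finset.sum_range_zero _

theorem sweep_succ {n : ℕ} (α β : ZMod n → ℝ) (k : ZMod n) (m : ℕ) :
    sweep α β k (m + 1) = sweep α β k m + (β (k + m) - α (k + m)) :=
  Finset.sum_range_succ _ _

theorem sweep_self {n : ℕ} [NeZero n] (α β : ZMod n → ℝ) (k : ZMod n) :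
    sweep α β k n = ∑ j, (β j - α j) :=
  Finset.sum_nbij' (fun i : ℕ => k + i) (fun j => (j - k).val) (by simp) (by simp [ZMod.val_lt])
    (fun i hi => by simp [ZMod.val_cast_of_lt (Finset.mem_range.mp hi)]) (by simp) (by simp)

theorem widthIn_neg (K : Set ℂ) (ν : ℂ) : widthIn K (-ν) = widthIn K ν := by
  have himage : (fun x : ℂ => ⟪-ν, x⟫_ℝ) '' K = -((fun x : ℂ => ⟪ν, x⟫_ℝ) '' K) := by
    simp only [inner_neg_left, ← Set.image_neg_eq_neg, Set.image_image]
  rw [widthIn, widthIn, himage, Real.sInf_def, Real.sInf_def, neg_neg, sub_neg_eq_add, add_comm,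
    sub_neg_eq_add]

namespace IsUnitStar

variable {N : ℕ} {P : ZMod (2 * N + 1) → ℂ} {α β : ZMod (2 * N + 1) → ℝ}

theorem vertex_mem (h : IsUnitStar P α β) (j : ZMod (2 * N + 1)) : P j ∈ diskInter P :=
  mem_diskInter.mpr (h.norm_sub_le j)

theorem unitVec_β_succ (h : IsUnitStar P α β) (k : ZMod (2 * N + 1)) :
    unitVec (β (k + 1)) = -unitVec (α k) := by
  have hpred := h.pred (k + 1)
  rw [add_sub_cancel_right, h.succ k] at hpred
  linear_combination -hpred

theorem norm_sub_arc_le (h : IsUnitStar P α β) {x : ℂ} (hx : x ∈ diskInter P)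
    {j : ZMod (2 * N + 1)} {t : ℝ} (ht : t ∈ Set.Icc (α j) (β j)) :
    ‖x - P j - unitVec t‖ ≤ 1 := by
  refine norm_sub_unitVec_le_one_of_mem_Icc (h.lt_add_pi j) ht ?_ ?_
  · simpa only [h.succ, sub_sub] using mem_diskInter.mp hx (j + 1)
  · simpa only [h.pred, sub_sub] using mem_diskInter.mp hx (j - 1)

theorem arc_mem (h : IsUnitStar P α β) {j : ZMod (2 * N + 1)} {t : ℝ}
    (ht : t ∈ Set.Icc (α j) (β j)) : P j + unitVec t ∈ diskInter P :=
  mem_diskInter.mpr fun i => by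
    rw [norm_sub_rev, ← sub_sub]
    exact h.norm_sub_arc_le (h.vertex_mem i) ht

theorem inner_mem_Icc (h : IsUnitStar P α β) {j : ZMod (2 * N + 1)} {t : ℝ}
    (ht : t ∈ Set.Icc (α j) (β j)) {x : ℂ} (hx : x ∈ diskInter P) :
    ⟪unitVec t, x⟫_ℝ ∈ Set.Icc ⟪unitVec t, P j⟫_ℝ (⟪unitVec t, P j⟫_ℝ + 1) := by
  have hlower := (norm_sub_le_one_iff (norm_unitVec t)).mp (h.norm_sub_arc_le hx ht)
  have hupper := real_inner_le_norm (unitVec t) (x - P j)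
  rw [norm_unitVec, one_mul] at hupper
  rw [inner_sub_right] at hlower hupper
  constructor
  · linarith [sq_nonneg ‖x - P j‖]
  · linarith [mem_diskInter.mp hx j]

theorem eq_arc_point (h : IsUnitStar P α β) {i j : ZMod (2 * N + 1)} {t : ℝ}
    (ht : t ∈ Set.Icc (α j) (β j)) (hi : P i + unitVec t ∈ diskInter P) :
    P i = P j := by
  have hle := (h.inner_mem_Icc ht (h.vertex_mem i)).1
  have := eq_add_unitVec_of_one_le_inner (j := j) (t := t) hi (by
    rw [inner_sub_right, inner_add_right, inner_unitVec_self]; linarith)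
  exact add_right_cancel this

theorem strictMono_sweep (h : IsUnitStar P α β) (k : ZMod (2 * N + 1)) :
    StrictMono (sweep α β k) :=
  strictMono_nat_of_lt_succ fun m => by linarith [sweep_succ α β k m, h.lt (k + m)]

/-- Passing from one arc to the next one turns the end direction by `π`, whence the sign. -/
theorem unitVec_sweep (h : IsUnitStar P α β) (k : ZMod (2 * N + 1)) (m : ℕ) (τ : ℝ) :
    (-1) ^ m * unitVec (β k - sweep α β k m - τ) = unitVec (β (k + m) - τ) := by
  induction m generalizing τ with
  | zero => simp [sweep_zero]
  | succ m ih =>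
    calc (-1) ^ (m + 1) * unitVec (β k - sweep α β k (m + 1) - τ)
        = -((-1) ^ m *
            unitVec (β k - sweep α β k m - (β (k + m) - α (k + m) + τ))) := by
          rw [sweep_succ, pow_succ]
          ring_nf
      _ = -unitVec (α (k + m)) * unitVec (-τ) := by
          rw [ih, neg_mul, ← unitVec_add]
          ring_nf
      _ = unitVec (β (k + (m + 1 : ℕ)) - τ) := by
          rw [← h.unitVec_β_succ, ← unitVec_add, ← sub_eq_add_neg, Nat.cast_succ, add_assoc]

theorem exists_sum_angles_eq (h : IsUnitStar P α β) :
    ∃ z : ℕ, ∑ j, (β j - α j) = Real.pi + z * (2 * Real.pi) := by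
  set s := ∑ j, (β j - α j) with hs
  have hturn := h.unitVec_sweep 0 (2 * N + 1) (β 0 - s)
  rw [sweep_self, ← hs, ZMod.natCast_self, add_zero, sub_self, Odd.neg_one_pow ⟨N, rfl⟩,
    sub_sub_cancel] at hturn
  have hcos : Real.cos (s - Real.pi) = 1 := by
    rw [Real.cos_sub_pi, ← unitVec_re, ← hturn]
    simp
  obtain ⟨z, hz⟩ := (Real.cos_eq_one_iff _).mp hcos
  have hpos : 0 < s := Finset.sum_pos (fun j _ => sub_pos.mpr (h.lt j)) Finset.univ_nonempty
  have hz0 : 0 ≤ z := by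
    by_contra! hneg
    have : (z : ℝ) ≤ -1 := by exact_mod_cast Int.le_sub_one_of_lt hneg
    nlinarith [Real.pi_pos]
  lift z to ℕ using hz0
  exact ⟨z, by rw [Int.cast_natCast] at hz; linarith⟩

theorem exists_label_of_sweep (h : IsUnitStar P α β) (k : ZMod (2 * N + 1)) {τ : ℝ}
    (hτ : τ ∈ Set.Ioc 0 (∑ j, (β j - α j))) :
    ∃ m < 2 * N + 1, τ ≤ sweep α β k (m + 1) ∧ ∃ t ∈ Set.Icc (α (k + m)) (β (k + m)),
      unitVec (β k - τ) = unitVec t ∨ unitVec (β k - τ) = -unitVec t := by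
  rw [← sweep_self α β k, ← sweep_zero α β k,
    ← (h.strictMono_sweep k).monotone.biUnion_Ico_Ioc_map_succ] at hτ
  simp only [Set.mem_iUnion, Set.mem_Ico, Nat.zero_le, true_and, Order.succ_eq_add_one] at hτ
  obtain ⟨m, hm, hlt, hle⟩ := hτ
  refine ⟨m, hm, hle, β (k + m) - (τ - sweep α β k m), ⟨?_, by linarith⟩, ?_⟩
  · rw [sweep_succ] at hle
    linarith
  · rw [← h.unitVec_sweep k m, show β k - sweep α β k m - (τ - sweep α β k m) = β k - τ by ring]
    rcases neg_one_pow_eq_or ℂ m with hsign | hsign <;> simp [hsign]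

theorem exists_arc_direction (h : IsUnitStar P α β) (s : ℝ) :
    ∃ j, ∃ t ∈ Set.Icc (α j) (β j), unitVec s = unitVec t ∨ unitVec s = -unitVec t := by
  obtain ⟨z, hz⟩ := h.exists_sum_angles_eq
  set τ := toIocMod Real.pi_pos 0 (β 0 - s)
  have hτ := toIocMod_mem_Ioc Real.pi_pos 0 (β 0 - s)
  have hmod : β 0 - τ = s - (-toIocDiv Real.pi_pos 0 (β 0 - s) : ℤ) * Real.pi := by
    have := toIocMod_add_toIocDiv_zsmul Real.pi_pos 0 (β 0 - s)
    rw [zsmul_eq_mul] at this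
    push_cast
    linarith
  have hz0 : (0 : ℝ) ≤ z * (2 * Real.pi) := by positivity
  obtain ⟨m, -, -, t, ht, hst⟩ := h.exists_label_of_sweep 0 ⟨hτ.1, by linarith [hτ.2]⟩
  refine ⟨_, t, ht, ?_⟩
  rw [hmod] at hst
  rcases unitVec_sub_int_mul_pi s (-toIocDiv Real.pi_pos 0 (β 0 - s)) with hs | hs <;>
    rw [hs] at hst
  · exact hst
  · exact hst.symm.imp neg_injective.eq_iff.mp neg_eq_iff_eq_neg.mp

theorem frontier_diskInter (h : IsUnitStar P α β) :
    frontier (diskInter P) = ⋃ k, unitArc (P k) (α k) (β k) := by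
  ext x
  rw [mem_frontier_diskInter, Set.mem_iUnion]
  refine ⟨fun ⟨hx, j, hj⟩ => ?_, ?_⟩
  · obtain ⟨s, hs⟩ := exists_unitVec_eq hj
    obtain rfl : x = P j + unitVec s := by rw [hs]; ring
    obtain ⟨i, t, ht, hst | hst⟩ := h.exists_arc_direction s
    · rw [hst] at hx ⊢
      exact ⟨i, t, ht, by rw [h.eq_arc_point ht hx]⟩
    · have hle := (h.inner_mem_Icc ht hx).1
      rw [hst, inner_add_right, inner_neg_right, inner_unitVec_self] at hle
      have hji : P j = P i + unitVec t := eq_add_unitVec_of_one_le_inner (h.vertex_mem j) (by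
        rw [inner_sub_right]; linarith)
      refine ⟨i - 1, α (i - 1), ⟨le_rfl, (h.lt _).le⟩, ?_⟩
      rw [hst, hji, add_neg_cancel_right]
      exact (h.succ (i - 1)).symm.trans (congrArg P (sub_add_cancel i 1))
  · rintro ⟨j, t, ht, rfl⟩
    exact ⟨h.arc_mem ht, j, by simp⟩

theorem widthIn_eq_one (h : IsUnitStar P α β) {ν : ℂ} (hν : ‖ν‖ = 1) :
    widthIn (diskInter P) ν = 1 := by
  obtain ⟨s, rfl⟩ := exists_unitVec_eq hν
  obtain ⟨j, t, ht, hst⟩ := h.exists_arc_direction s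
  have hgreatest : IsGreatest ((fun x : ℂ => ⟪unitVec t, x⟫_ℝ) '' diskInter P)
      (⟪unitVec t, P j⟫_ℝ + 1) :=
    ⟨⟨_, h.arc_mem ht, by simp only [inner_add_right, inner_unitVec_self]⟩,
      Set.forall_mem_image.mpr fun x hx => (h.inner_mem_Icc ht hx).2⟩
  have hleast : IsLeast ((fun x : ℂ => ⟪unitVec t, x⟫_ℝ) '' diskInter P) ⟪unitVec t, P j⟫_ℝ :=
    ⟨⟨_, h.vertex_mem j, rfl⟩, Set.forall_mem_image.mpr fun x hx => (h.inner_mem_Icc ht hx).1⟩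
  have hwidth : widthIn (diskInter P) (unitVec t) = 1 := by
    rw [widthIn, hgreatest.csSup_eq, hleast.csInf_eq, add_sub_cancel_left]
  rcases hst with hst | hst <;> rw [hst]
  · exact hwidth
  · rw [widthIn_neg, hwidth]

theorem isConstantWidthOne (h : IsUnitStar P α β) (hint : (interior (diskInter P)).Nonempty) :
    IsConstantWidthOne (diskInter P) :=
  ⟨isCompact_diskInter P, convex_diskInter P, hint, fun _ hν => h.widthIn_eq_one hν⟩

theorem unitVec_eq_of_isMaxOn (h : IsUnitStar P α β) {j : ZMod (2 * N + 1)} {s t : ℝ}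
    (ht : t ∈ Set.Ioo (α j) (β j))
    (hs : IsMaxOn (fun x => ⟪unitVec s, x⟫_ℝ) (diskInter P) (P j + unitVec t)) :
    unitVec s = unitVec t := by
  have hmax : IsLocalMax (fun τ => Real.cos (s - τ)) t := by
    filter_upwards [Ioo_mem_nhds ht.1 ht.2] with τ hτ
    have hle : ⟪unitVec s, P j + unitVec τ⟫_ℝ ≤ ⟪unitVec s, P j + unitVec t⟫_ℝ :=
      hs (h.arc_mem (Set.Ioo_subset_Icc_self hτ))
    simpa only [inner_add_right, inner_unitVec, add_le_add_iff_left] using hle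
  have hder : HasDerivAt (fun τ => Real.cos (s - τ)) (Real.sin (s - t)) t := by
    simpa using ((hasDerivAt_id t).const_sub s).cos
  have hsin : Real.sin (s - t) = 0 := hmax.hasDerivAt_eq_zero hder
  have hcos0 : 0 ≤ Real.cos (s - t) := by
    have hle : ⟪unitVec s, P j⟫_ℝ ≤ ⟪unitVec s, P j + unitVec t⟫_ℝ := hs (h.vertex_mem j)
    rwa [inner_add_right, inner_unitVec, le_add_iff_nonneg_right] at hle
  have hcos : Real.cos (s - t) = 1 := by
    nlinarith [Real.sin_sq_add_cos_sq (s - t)]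
  rw [← inner_unitVec] at hcos
  exact (inner_eq_one_iff_of_norm_eq_one (norm_unitVec s) (norm_unitVec t)).mp hcos

theorem arc_point_ne_vertex (h : IsUnitStar P α β) {i : ZMod (2 * N + 1)} {t : ℝ}
    (ht : t ∈ Set.Ioo (α i) (β i)) (j : ZMod (2 * N + 1)) : P i + unitVec t ≠ P j := by
  intro hij
  have hneg : ∀ s ∈ Set.Icc (α j) (β j), -unitVec s = unitVec t := by
    intro s hs
    rw [← unitVec_add_pi]
    refine h.unitVec_eq_of_isMaxOn ht fun x hx => ?_
    simp only [Set.mem_ofPred_eq, hij, unitVec_add_pi, inner_neg_left, neg_le_neg_iff]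
    exact (h.inner_mem_Icc hs hx).1
  refine unitVec_ne_of_lt_of_lt_add_pi (h.lt j) (h.lt_add_pi j) (neg_injective ?_)
  rw [hneg _ (Set.left_mem_Icc.mpr (h.lt j).le), hneg _ (Set.right_mem_Icc.mpr (h.lt j).le)]

theorem label_eq_of_direction (h : IsUnitStar P α β) (hP : Function.Injective P)
    {i j : ZMod (2 * N + 1)} {s t : ℝ} (ht : t ∈ Set.Ioo (α i) (β i))
    (hs : s ∈ Set.Icc (α j) (β j)) (hst : unitVec s = unitVec t ∨ unitVec s = -unitVec t) :
    i = j := by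
  have hit := h.arc_mem (Set.Ioo_subset_Icc_self ht)
  rcases hst with hst | hst
  · refine hP (h.eq_arc_point hs ?_)
    rwa [hst]
  · refine absurd ?_ (h.arc_point_ne_vertex ht j)
    have hle := (h.inner_mem_Icc hs hit).1
    rw [hst, inner_add_right, inner_neg_left, inner_neg_left, inner_neg_left,
      inner_unitVec_self] at hle
    exact (eq_add_unitVec_of_one_le_inner (h.vertex_mem j) (by
      rw [inner_sub_right]; linarith)).symm

/-- If the arcs swept more than `π`, then the arc opposite to an interior point of the arc `k`
would be another one with the same direction. -/
theorem sum_angles (h : IsUnitStar P α β) (hP : Function.Injective P) :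
    ∑ j, (β j - α j) = Real.pi := by
  obtain ⟨z, hz⟩ := h.exists_sum_angles_eq
  rcases Nat.eq_zero_or_pos z with rfl | hz0
  · simpa using hz
  exfalso
  have hz1 : (1 : ℝ) ≤ z := by exact_mod_cast hz0
  set η := (β 0 - α 0) / 2 with hη
  have hlt := h.lt 0
  have hlt_pi := h.lt_add_pi 0
  obtain ⟨m, hm, hle, t, ht, hst⟩ := h.exists_label_of_sweep 0 (τ := η + Real.pi)
    ⟨by linarith [Real.pi_pos], by nlinarith [Real.pi_pos]⟩
  rw [show β 0 - (η + Real.pi) = β 0 - η - Real.pi by ring, unitVec_sub_pi] at hst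
  have hlabel : (0 : ZMod (2 * N + 1)) = 0 + m :=
    h.label_eq_of_direction hP (t := β 0 - η) ⟨by linarith, by linarith⟩ ht
      (hst.symm.imp (fun e => (neg_injective e).symm) Eq.symm)
  have hm0 : m = 0 := Nat.eq_zero_of_dvd_of_lt
    ((ZMod.natCast_eq_zero_iff m _).mp (by simpa using hlabel.symm)) hm
  rw [hm0, sweep_succ, sweep_zero, Nat.cast_zero, add_zero] at hle
  linarith

theorem adjacent_of_sub_eq_unitVec (h : IsUnitStar P α β) (hP : Function.Injective P)
    {i j m : ZMod (2 * N + 1)} {t : ℝ} (ht : t ∈ Set.Icc (α m) (β m))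
    (hij : P i - P j = unitVec t) : i = j + 1 ∨ j = i + 1 := by
  have hi : P i = P j + unitVec t := by rw [← hij]; ring
  obtain rfl : j = m := hP (h.eq_arc_point ht (hi ▸ h.vertex_mem i))
  rcases ht.1.eq_or_lt with hα | hα
  · left
    exact hP (by rw [hi, ← hα, h.succ])
  rcases ht.2.eq_or_lt with hβ | hβ
  · right
    rw [← hP (show P (j - 1) = P i by rw [hi, hβ, h.pred]), sub_add_cancel]
  · exact absurd hi.symm (h.arc_point_ne_vertex ⟨hα, hβ⟩ i)

theorem adjacent_of_norm_sub_eq_one (h : IsUnitStar P α β) (hP : Function.Injective P)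
    {i j : ZMod (2 * N + 1)} (hij : ‖P i - P j‖ = 1) : i = j + 1 ∨ j = i + 1 := by
  obtain ⟨s, hs⟩ := exists_unitVec_eq hij
  obtain ⟨m, t, ht, hst | hst⟩ := h.exists_arc_direction s
  · exact h.adjacent_of_sub_eq_unitVec hP ht (hs.symm.trans hst)
  · refine (h.adjacent_of_sub_eq_unitVec hP ht ?_).symm
    rw [← neg_sub, ← hs, hst, neg_neg]

end IsUnitStar

/-! ### Reuleaux polygons and their incircles -/

theorem IsConstantWidthOne.norm_sub_le {K : Set ℂ} (hK : IsConstantWidthOne K) {x y : ℂ}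
    (hx : x ∈ K) (hy : y ∈ K) : ‖x - y‖ ≤ 1 := by
  rcases eq_or_ne x y with rfl | hxy
  · simp
  set ν : ℂ := ‖x - y‖⁻¹ • (x - y) with hν
  have hwidth := hK.width_eq ν (norm_smul_inv_norm (sub_ne_zero.mpr hxy))
  have hcomp : IsCompact ((fun z : ℂ => ⟪ν, z⟫_ℝ) '' K) := hK.isCompact.image (by fun_prop)
  have hsup : ⟪ν, x⟫_ℝ ≤ sSup ((fun z : ℂ => ⟪ν, z⟫_ℝ) '' K) :=
    le_csSup hcomp.bddAbove ⟨x, hx, rfl⟩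
  have hinf : sInf ((fun z : ℂ => ⟪ν, z⟫_ℝ) '' K) ≤ ⟪ν, y⟫_ℝ :=
    csInf_le hcomp.bddBelow ⟨y, hy, rfl⟩
  have hnorm : ⟪ν, x⟫_ℝ - ⟪ν, y⟫_ℝ = ‖x - y‖ := by
    rw [← inner_sub_right, hν, real_inner_smul_left, real_inner_self_eq_norm_sq, sq,
      inv_mul_cancel_left₀ (norm_ne_zero_iff.mpr (sub_ne_zero.mpr hxy))]
  rw [widthIn] at hwidth
  linarith

theorem exists_unitVec_of_areaForm_pos {u v : ℂ} (hu : ‖u‖ = 1) (hv : ‖v‖ = 1)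
    (h : 0 < areaForm u v) :
    ∃ a b : ℝ, a < b ∧ b < a + Real.pi ∧ unitVec a = u ∧ unitVec b = v := by
  obtain ⟨a, rfl⟩ := exists_unitVec_eq hu
  obtain ⟨b, rfl⟩ := exists_unitVec_eq hv
  set c := (unitVec (b - a)).arg
  have hunit : unitVec c = unitVec (b - a) := unitVec_arg (norm_unitVec _)
  have hsin : 0 < Real.sin c := by
    rwa [← unitVec_im, hunit, unitVec_im, ← areaForm_unitVec]
  have hpos : 0 < c := by
    by_contra! hneg
    exact (Real.sin_nonpos_of_nonpos_of_neg_pi_le hneg (Complex.neg_pi_lt_arg _).le).not_gt hsin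
  have hlt : c < Real.pi := (Complex.arg_le_pi _).lt_of_ne fun hpi => by
    rw [show c = Real.pi from hpi, Real.sin_pi] at hsin
    exact hsin.false
  refine ⟨a, a + c, by linarith, by linarith, rfl, ?_⟩
  rw [unitVec_add, hunit, ← unitVec_add, add_sub_cancel]

namespace ReuleauxPolygon

variable {N : ℕ} {r : ℝ}

theorem arc_mem_frontier (Q : ReuleauxPolygon N) {k : ZMod (2 * N + 1)} {t : ℝ}
    (ht : t ∈ Set.Icc (Q.α k) (Q.β k)) : Q.vertex k + unitVec t ∈ frontier Q.body := by
  rw [Q.frontier_eq]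
  exact Set.mem_iUnion.mpr ⟨k, t, ht, rfl⟩

theorem arc_mem_body (Q : ReuleauxPolygon N) {k : ZMod (2 * N + 1)} {t : ℝ}
    (ht : t ∈ Set.Icc (Q.α k) (Q.β k)) : Q.vertex k + unitVec t ∈ Q.body :=
  Q.constantWidth.isCompact.isClosed.frontier_subset (Q.arc_mem_frontier ht)

theorem vertex_mem_body (Q : ReuleauxPolygon N) (k : ZMod (2 * N + 1)) : Q.vertex k ∈ Q.body := by
  have hmem := Q.arc_mem_body (Set.left_mem_Icc.mpr (Q.α_lt_β (k - 1)).le)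
  rwa [← Q.vertex_succ, sub_add_cancel] at hmem

theorem isUnitStar (Q : ReuleauxPolygon N) : IsUnitStar Q.vertex Q.α Q.β where
  lt := Q.α_lt_β
  lt_add_pi k := by
    by_contra! hle
    have hdist := Q.constantWidth.norm_sub_le
      (Q.arc_mem_body (Set.left_mem_Icc.mpr (Q.α_lt_β k).le))
      (Q.arc_mem_body (k := k) (t := Q.α k + Real.pi) ⟨by linarith [Real.pi_pos], hle⟩)
    rw [unitVec_add_pi, add_sub_add_left_eq_sub, sub_neg_eq_add, ← two_mul, norm_mul,
      norm_unitVec] at hdist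
    norm_num at hdist
  succ := Q.vertex_succ
  pred := Q.vertex_pred
  norm_sub_le i j := Q.constantWidth.norm_sub_le (Q.vertex_mem_body i) (Q.vertex_mem_body j)

theorem body_eq (Q : ReuleauxPolygon N) : Q.body = diskInter Q.vertex :=
  eq_of_frontier_eq Q.constantWidth.isCompact.isClosed Q.constantWidth.interior_nonempty
    (convex_diskInter _)
    (fun _ hx => mem_diskInter.mpr fun j => Q.constantWidth.norm_sub_le hx (Q.vertex_mem_body j))
    (by rw [Q.isUnitStar.frontier_diskInter, Q.frontier_eq])

theorem norm_vertex_sub_lt_one (Q : ReuleauxPolygon N) {i j : ZMod (2 * N + 1)}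
    (hij : i ≠ j + 1) (hji : j ≠ i + 1) : ‖Q.vertex i - Q.vertex j‖ < 1 :=
  (Q.isUnitStar.norm_sub_le i j).lt_of_ne fun h =>
    (Q.isUnitStar.adjacent_of_norm_sub_eq_one Q.vertex_injective h).elim hij hji

theorem inradius_pos (Q : ReuleauxPolygon N) (hr : HasInradius Q.body r) : 0 < r := by
  obtain ⟨p, hp⟩ := Q.constantWidth.interior_nonempty
  obtain ⟨ε, hε, hball⟩ := Metric.isOpen_iff.mp isOpen_interior p hp
  exact hε.trans_le (hr.2 ⟨p, hball.trans interior_subset⟩)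

theorem hasCentredIncircle_iff (Q : ReuleauxPolygon N) (hr : 0 < r) :
    HasCentredIncircle Q.body r ↔ (∀ k, ‖Q.vertex k‖ ≤ 1 - r) ∧
      (0 : ℂ) ∈ convexHull ℝ (Q.vertex '' {k | ‖Q.vertex k‖ = 1 - r}) := by
  rw [Q.body_eq, hasCentredIncircle_diskInter_iff hr]

theorem norm_vertex_le (Q : ReuleauxPolygon N) (hr : HasCentredIncircle Q.body r)
    (k : ZMod (2 * N + 1)) : ‖Q.vertex k‖ ≤ 1 - r :=
  ((Q.hasCentredIncircle_iff (Q.inradius_pos hr.1)).mp hr).1 k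

theorem zero_mem_convexHull (Q : ReuleauxPolygon N) (hr : HasCentredIncircle Q.body r) :
    (0 : ℂ) ∈ convexHull ℝ (Q.vertex '' {k | ‖Q.vertex k‖ = 1 - r}) :=
  ((Q.hasCentredIncircle_iff (Q.inradius_pos hr.1)).mp hr).2

theorem closedBall_subset_body (Q : ReuleauxPolygon N) (hr : HasCentredIncircle Q.body r) :
    closedBall 0 r ⊆ Q.body := by
  rw [← closure_ball (0 : ℂ) (Q.inradius_pos hr.1).ne']
  exact closure_minimal hr.2 Q.constantWidth.isCompact.isClosed

/-- A vertex at distance `r` from the centre would support the incircle in the directions of all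
points of its arc. -/
theorem lt_norm_vertex (Q : ReuleauxPolygon N) (hr : HasCentredIncircle Q.body r)
    (k : ZMod (2 * N + 1)) : r < ‖Q.vertex k‖ := by
  have hpos := Q.inradius_pos hr.1
  by_contra! hle
  have hdir : ∀ t ∈ Set.Icc (Q.α k) (Q.β k), -Q.vertex k = r • unitVec t := by
    intro t ht
    have hmem : -(r • unitVec t) ∈ diskInter Q.vertex := Q.body_eq ▸
      Q.closedBall_subset_body hr (by simp [abs_of_pos hpos])
    refine eq_smul_of_le_inner (norm_unitVec t) (by rwa [norm_neg]) ?_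
    have hsupp := (Q.isUnitStar.inner_mem_Icc ht hmem).1
    rw [inner_neg_right, real_inner_smul_right, inner_unitVec_self] at hsupp
    rw [inner_neg_right]
    linarith
  have hlt := Q.α_lt_β k
  refine unitVec_ne_of_lt_of_lt_add_pi hlt (Q.isUnitStar.lt_add_pi k)
    (smul_right_injective ℂ hpos.ne' ?_)
  exact (hdir _ (Set.left_mem_Icc.mpr hlt.le)).symm.trans (hdir _ (Set.right_mem_Icc.mpr hlt.le))

theorem exists_arc_direction_of_norm_vertex_eq (Q : ReuleauxPolygon N)
    (hr : HasCentredIncircle Q.body r) {k : ZMod (2 * N + 1)} (hk : ‖Q.vertex k‖ = 1 - r) :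
    ∃ t ∈ Set.Icc (Q.α k) (Q.β k), Q.vertex k = -((1 - r) • unitVec t) := by
  have hpos := Q.inradius_pos hr.1
  have hR : 0 < 1 - r := by linarith [Q.lt_norm_vertex hr k]
  obtain ⟨s, hs⟩ := exists_unitVec_eq (z := -((1 - r)⁻¹ • Q.vertex k)) (by
    rw [norm_neg, norm_smul, hk, norm_inv, Real.norm_of_nonneg hR.le, inv_mul_cancel₀ hR.ne'])
  have hk_eq : Q.vertex k = -((1 - r) • unitVec s) := by
    rw [hs, smul_neg, smul_inv_smul₀ hR.ne', neg_neg]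
  have hfront : r • unitVec s ∈ frontier Q.body := by
    rw [Q.body_eq, mem_frontier_diskInter, ← Q.body_eq]
    refine ⟨Q.closedBall_subset_body hr (by simp [abs_of_pos hpos]), k, ?_⟩
    rw [hk_eq, sub_neg_eq_add, ← add_smul, add_sub_cancel, one_smul, norm_unitVec]
  rw [Q.frontier_eq, Set.mem_iUnion] at hfront
  obtain ⟨m, t, ht, hst : Q.vertex m + unitVec t = r • unitVec s⟩ := hfront
  have hm : -Q.vertex m = (1 - r) • unitVec t := by
    refine eq_smul_of_le_inner (norm_unitVec t) (by rw [norm_neg]; exact Q.norm_vertex_le hr m) ?_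
    rw [show -Q.vertex m = unitVec t - r • unitVec s by rw [← hst]; abel, inner_sub_right,
      inner_unitVec_self, real_inner_smul_right, inner_unitVec]
    nlinarith [Real.cos_le_one (t - s)]
  have hst' : unitVec s = unitVec t := smul_right_injective ℂ hpos.ne' <| by
    simp only [← hst, neg_eq_iff_eq_neg.mp hm, sub_smul, one_smul]
    abel
  obtain rfl : k = m := Q.vertex_injective (by rw [hk_eq, hst', neg_eq_iff_eq_neg.mp hm])
  exact ⟨t, ht, by rw [hk_eq, hst']⟩

theorem exists_tangent (Q : ReuleauxPolygon N) (hr : HasCentredIncircle Q.body r)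
    {k : ZMod (2 * N + 1)} (hk : ‖Q.vertex k‖ = 1 - r) :
    ∃ t ∈ Set.Ioo (Q.α k) (Q.β k), Q.vertex k = -((1 - r) • unitVec t) := by
  obtain ⟨t, ht, hk_eq⟩ := Q.exists_arc_direction_of_norm_vertex_eq hr hk
  have hnorm : ‖Q.vertex k + unitVec t‖ = r := by
    rw [hk_eq, sub_smul, one_smul, neg_sub, sub_add_cancel, norm_smul, norm_unitVec, mul_one,
      Real.norm_of_nonneg (Q.inradius_pos hr.1).le]
  refine ⟨t, ⟨ht.1.lt_of_ne fun hα => ?_, ht.2.lt_of_ne fun hβ => ?_⟩, hk_eq⟩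
  · exact (Q.lt_norm_vertex hr (k + 1)).ne' (by rw [Q.vertex_succ, hα, hnorm])
  · exact (Q.lt_norm_vertex hr (k - 1)).ne' (by rw [Q.vertex_pred, ← hβ, hnorm])

theorem isTangentArc (Q : ReuleauxPolygon N) (hr : HasCentredIncircle Q.body r)
    {k : ZMod (2 * N + 1)} (hk : ‖Q.vertex k‖ = 1 - r) : Q.IsTangentArc r k := by
  obtain ⟨t, ht, hk_eq⟩ := Q.exists_tangent hr hk
  refine ⟨t, Set.Ioo_subset_Icc_self ht, ?_⟩
  rw [hk_eq, Complex.real_smul]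
  push_cast
  ring

theorem exists_of_vertices {P : ZMod (2 * N + 1) → ℂ} (hinj : Function.Injective P)
    (hlink : ∀ k, ‖P (k + 1) - P k‖ = 1) (hdist : ∀ i j, ‖P i - P j‖ ≤ 1)
    (hturn : ∀ k, 0 < areaForm (P (k + 1) - P k) (P (k - 1) - P k))
    (hr : 0 < r) (hP : ∀ k, ‖P k‖ ≤ 1 - r) : ∃ Q : ReuleauxPolygon N, Q.vertex = P := by
  have hpred : ∀ k, ‖P (k - 1) - P k‖ = 1 := fun k => by
    simpa only [sub_add_cancel, norm_sub_rev] using hlink (k - 1)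
  choose α β hlt hlt_pi hα hβ using fun k =>
    exists_unitVec_of_areaForm_pos (hlink k) (hpred k) (hturn k)
  have hstar : IsUnitStar P α β :=
    ⟨hlt, hlt_pi, fun k => by rw [hα, add_sub_cancel], fun k => by rw [hβ, add_sub_cancel], hdist⟩
  have hball : ball 0 r ⊆ diskInter P :=
    (ball_subset_diskInter_iff hr).mpr (by simpa only [sub_zero] using hP)
  have hint : (interior (diskInter P)).Nonempty :=
    ⟨0, interior_maximal hball isOpen_ball (mem_ball_self hr)⟩
  exact ⟨⟨diskInter P, P, α, β, hstar.isConstantWidthOne hint, hinj, hlt, hstar.succ, hstar.pred,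
    hstar.frontier_diskInter⟩, rfl⟩

end ReuleauxPolygon

/-! ### Area -/

section Gauge

variable {E : Type*} [AddCommGroup E] [Module ℝ E] [TopologicalSpace E] [IsTopologicalAddGroup E]
  [ContinuousSMul ℝ E] {K : Set E}

theorem eq_and_eq_of_smul_eq_smul_of_mem_frontier (hK : Convex ℝ K) (h0 : K ∈ nhds 0) {x y : E}
    (hx : x ∈ frontier K) (hy : y ∈ frontier K) {c d : ℝ} (hc : 0 < c) (hd : 0 ≤ d)
    (h : c • x = d • y) : c = d ∧ x = y := by
  have hgauge := congrArg (gauge K) h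
  rw [gauge_smul_of_nonneg hc.le, gauge_smul_of_nonneg hd,
    (gauge_eq_one_iff_mem_frontier hK h0).mpr hx, (gauge_eq_one_iff_mem_frontier hK h0).mpr hy,
    smul_eq_mul, smul_eq_mul, mul_one, mul_one] at hgauge
  subst hgauge
  exact ⟨rfl, smul_right_injective E hc.ne' h⟩

theorem exists_mem_frontier_smul_eq [T1Space E] (hK : Convex ℝ K) (h0 : K ∈ nhds 0)
    (hb : Bornology.IsVonNBounded ℝ K) {x : E} (hx : x ∈ K) (hx0 : x ≠ 0) :
    ∃ y ∈ frontier K, ∃ c ∈ Set.Ioc (0 : ℝ) 1, x = c • y := by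
  have hpos : 0 < gauge K x := (gauge_pos (absorbent_nhds_zero h0) hb).mpr hx0
  refine ⟨(gauge K x)⁻¹ • x, ?_, gauge K x, ⟨hpos, gauge_le_one_of_mem hx⟩,
    (smul_inv_smul₀ hpos.ne' x).symm⟩
  rw [← gauge_eq_one_iff_mem_frontier hK h0, gauge_smul_of_nonneg (inv_nonneg.mpr hpos.le),
    smul_eq_mul, inv_mul_cancel₀ hpos.ne']

end Gauge

theorem volume_range_smul_eq_zero (v : ℂ) : volume (Set.range fun c : ℝ => c • v) = 0 := by
  have hne : Submodule.span ℝ {v} ≠ ⊤ := fun htop => by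
    have hle := finrank_span_le_card (R := ℝ) ({v} : Set ℂ)
    rw [htop, finrank_top, Complex.finrank_real_complex] at hle
    simp at hle
  have hrange : (Set.range fun c : ℝ => c • v) = Submodule.span ℝ {v} :=
    Set.ext fun _ => Submodule.mem_span_singleton.symm
  rw [hrange]
  exact Measure.addHaar_submodule volume _ hne

theorem hasDerivAt_unitVec (t : ℝ) : HasDerivAt unitVec (Complex.I * unitVec t) t := by
  have h := ((hasDerivAt_id t).ofReal_comp.mul_const Complex.I).cexp
  rwa [mul_comm, Complex.ofReal_one, one_mul] at h

@[fun_prop]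
theorem continuous_unitVec : Continuous unitVec :=
  continuous_iff_continuousAt.mpr fun t => (hasDerivAt_unitVec t).continuousAt

theorem areaForm_I_mul (z w : ℂ) : areaForm z (Complex.I * w) = ⟪z, w⟫_ℝ := by
  simp only [areaForm_apply, inner_eq_re_add_im, Complex.I_mul_re, Complex.I_mul_im]
  ring

/-- The parametrisation of the cone over a plane curve `γ` with apex at the origin: `z.re` is the
fraction of the segment from the apex to the point with parameter `z.im`. -/
noncomputable def coneMap (γ : ℝ → ℂ) (z : ℂ) : ℂ := z.re • γ z.im

/-- The derivative of `coneMap γ` at `z`, for a curve `γ` with velocity `γ'`. -/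
noncomputable def coneMapDeriv (γ γ' : ℝ → ℂ) (z : ℂ) : ℂ →L[ℝ] ℂ :=
  Complex.reCLM.smulRight (γ z.im) + Complex.imCLM.smulRight (z.re • γ' z.im)

section Cone

variable {γ γ' : ℝ → ℂ}

theorem hasFDerivAt_coneMap {z : ℂ} (hγ : HasDerivAt γ (γ' z.im) z.im) :
    HasFDerivAt (coneMap γ) (coneMapDeriv γ γ' z) z := by
  have him := hγ.hasFDerivAt.comp z Complex.imCLM.hasFDerivAt
  refine (Complex.reCLM.hasFDerivAt.smul him).congr_fderiv ?_
  ext v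
  simp [coneMapDeriv]
  ring

theorem det_coneMapDeriv (γ γ' : ℝ → ℂ) (z : ℂ) :
    (coneMapDeriv γ γ' z).det = z.re * areaForm (γ z.im) (γ' z.im) := by
  rw [ContinuousLinearMap.det, ← LinearMap.det_toMatrix Complex.basisOneI, Matrix.det_fin_two]
  simp [LinearMap.toMatrix_apply, coneMapDeriv, areaForm_apply]
  ring

theorem setLIntegral_reProdIm_mul {f g : ℝ → ENNReal} (hf : Measurable f) (hg : Measurable g)
    (s t : Set ℝ) :
    ∫⁻ z in s ×ℂ t, f z.re * g z.im = (∫⁻ x in s, f x) * ∫⁻ y in t, g y := by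
  calc ∫⁻ z in s ×ℂ t, f z.re * g z.im
      = ∫⁻ q in s ×ˢ t, f q.1 * g q.2 :=
        Complex.volume_preserving_equiv_real_prod.setLIntegral_comp_preimage_emb
          Complex.measurableEquivRealProd.measurableEmbedding (fun q => f q.1 * g q.2) (s ×ˢ t)
    _ = (∫⁻ x in s, f x) * ∫⁻ y in t, g y := by
        rw [Measure.volume_eq_prod, ← Measure.prod_restrict,
          lintegral_prod_mul hf.aemeasurable hg.aemeasurable]

theorem setLIntegral_Ioo_ofReal {f : ℝ → ℝ} {a b : ℝ} (hab : a ≤ b) (hf : Continuous f)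
    (hpos : ∀ x ∈ Set.Ioo a b, 0 ≤ f x) :
    ∫⁻ x in Set.Ioo a b, ENNReal.ofReal (f x) = ENNReal.ofReal (∫ x in a..b, f x) := by
  rw [intervalIntegral.integral_of_le hab, integral_Ioc_eq_integral_Ioo,
    ofReal_integral_eq_lintegral_ofReal]
  · exact (hf.integrableOn_Icc (a := a) (b := b)).mono_set Set.Ioo_subset_Icc_self
  · filter_upwards [ae_restrict_mem measurableSet_Ioo] with x hx using hpos x hx

theorem volume_coneMap_image {a b : ℝ} (hab : a ≤ b) (hγ : ∀ t, HasDerivAt γ (γ' t) t)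
    (hγ' : Continuous γ') (hpos : ∀ t ∈ Set.Ioo a b, 0 ≤ areaForm (γ t) (γ' t))
    (hinj : Set.InjOn (coneMap γ) (Set.Ioo 0 1 ×ℂ Set.Ioo a b)) :
    volume (coneMap γ '' (Set.Ioo 0 1 ×ℂ Set.Ioo a b)) =
      ENNReal.ofReal ((∫ t in a..b, areaForm (γ t) (γ' t)) / 2) := by
  have hmeas : MeasurableSet (Set.Ioo (0 : ℝ) 1 ×ℂ Set.Ioo a b) :=
    (isOpen_Ioo.reProdIm isOpen_Ioo).measurableSet
  have hcont : Continuous fun t => areaForm (γ t) (γ' t) := by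
    have : Continuous γ := continuous_iff_continuousAt.mpr fun t => (hγ t).continuousAt
    fun_prop
  have hdet : ∀ z ∈ Set.Ioo (0 : ℝ) 1 ×ℂ Set.Ioo a b,
      ENNReal.ofReal |(coneMapDeriv γ γ' z).det| =
        ENNReal.ofReal z.re * ENNReal.ofReal (areaForm (γ z.im) (γ' z.im)) := by
    rintro z ⟨hre, him⟩
    rw [det_coneMapDeriv, abs_of_nonneg (mul_nonneg hre.1.le (hpos _ him)),
      ENNReal.ofReal_mul hre.1.le]
  rw [← lintegral_abs_det_fderiv_eq_addHaar_image volume hmeas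
      (fun z _ => (hasFDerivAt_coneMap (hγ z.im)).hasFDerivWithinAt) hinj,
    setLIntegral_congr_fun hmeas hdet,
    setLIntegral_reProdIm_mul (f := ENNReal.ofReal)
      (g := fun t => ENNReal.ofReal (areaForm (γ t) (γ' t))) ENNReal.measurable_ofReal
      hcont.measurable.ennreal_ofReal,
    setLIntegral_Ioo_ofReal (f := fun x => x) zero_le_one continuous_id fun x hx => hx.1.le,
    setLIntegral_Ioo_ofReal hab hcont hpos, ← ENNReal.ofReal_mul (by simp), integral_id]
  congr 1
  ring

end Cone

theorem areaForm_arc (p : ℂ) (t : ℝ) :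
    areaForm (p + unitVec t) (Complex.I * unitVec t) = 1 + ⟪p, unitVec t⟫_ℝ := by
  rw [areaForm_I_mul, inner_add_left, inner_unitVec_self, add_comm]

theorem integral_areaForm_arc (p : ℂ) (a b : ℝ) :
    ∫ t in a..b, areaForm (p + unitVec t) (Complex.I * unitVec t) =
      b - a + areaForm p (unitVec b - unitVec a) := by
  have hder : ∀ t ∈ Set.uIcc a b, HasDerivAt (fun t => t + areaForm p (unitVec t))
      (areaForm (p + unitVec t) (Complex.I * unitVec t)) t := by
    intro t _
    rw [areaForm_arc, ← areaForm_I_mul]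
    exact (hasDerivAt_id t).add ((areaForm p).hasFDerivAt.comp_hasDerivAt t (hasDerivAt_unitVec t))
  rw [intervalIntegral.integral_eq_sub_of_hasDerivAt hder
    (Continuous.intervalIntegrable (by fun_prop) _ _), map_sub]
  ring

namespace ReuleauxPolygon

variable {N : ℕ} {r : ℝ}

/-- The open sector of the arc `Γ k` seen from the origin. -/
def sector (Q : ReuleauxPolygon N) (k : ZMod (2 * N + 1)) : Set ℂ :=
  coneMap (fun t => Q.vertex k + unitVec t) '' (Set.Ioo 0 1 ×ℂ Set.Ioo (Q.α k) (Q.β k))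

theorem body_mem_nhds_zero (Q : ReuleauxPolygon N) (hr : HasCentredIncircle Q.body r) :
    Q.body ∈ nhds 0 :=
  Filter.mem_of_superset (ball_mem_nhds 0 (Q.inradius_pos hr.1)) hr.2

theorem eq_and_eq_of_arc_point_eq (Q : ReuleauxPolygon N) {i j : ZMod (2 * N + 1)} {s t : ℝ}
    (hs : s ∈ Set.Ioo (Q.α i) (Q.β i)) (ht : t ∈ Set.Ioo (Q.α j) (Q.β j))
    (h : Q.vertex i + unitVec s = Q.vertex j + unitVec t) : i = j ∧ s = t := by
  have hdir : unitVec s = unitVec t := by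
    refine Q.isUnitStar.unitVec_eq_of_isMaxOn ht fun x hx => ?_
    simp only [Set.mem_ofPred_eq, ← h, inner_add_right, inner_unitVec_self]
    exact (Q.isUnitStar.inner_mem_Icc (Set.Ioo_subset_Icc_self hs) hx).2
  obtain rfl : i = j := Q.vertex_injective (add_right_cancel (hdir ▸ h))
  have hsin : Real.sin (t - s) = 0 := by rw [← areaForm_unitVec, hdir, areaForm_self]
  have hlt_pi := Q.isUnitStar.lt_add_pi i
  have hzero := (Real.sin_eq_zero_iff_of_lt_of_lt (by linarith [hs.2, ht.1])
    (by linarith [hs.1, ht.2])).mp hsin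
  exact ⟨rfl, by linarith⟩

theorem eq_and_eq_of_coneMap_eq (Q : ReuleauxPolygon N) (hr : HasCentredIncircle Q.body r)
    {i j : ZMod (2 * N + 1)} {z w : ℂ} (hz : z ∈ Set.Ioo 0 1 ×ℂ Set.Ioo (Q.α i) (Q.β i))
    (hw : w ∈ Set.Ioo 0 1 ×ℂ Set.Ioo (Q.α j) (Q.β j))
    (h : coneMap (fun t => Q.vertex i + unitVec t) z =
      coneMap (fun t => Q.vertex j + unitVec t) w) :
    i = j ∧ z = w := by
  obtain ⟨hre, hpoint⟩ := eq_and_eq_of_smul_eq_smul_of_mem_frontier Q.constantWidth.convex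
    (Q.body_mem_nhds_zero hr) (Q.arc_mem_frontier (Set.Ioo_subset_Icc_self hz.2))
    (Q.arc_mem_frontier (Set.Ioo_subset_Icc_self hw.2)) hz.1.1 hw.1.1.le h
  obtain ⟨hij, him⟩ := Q.eq_and_eq_of_arc_point_eq hz.2 hw.2 hpoint
  exact ⟨hij, Complex.ext hre him⟩

theorem sector_subset_body (Q : ReuleauxPolygon N) (hr : HasCentredIncircle Q.body r)
    (k : ZMod (2 * N + 1)) : Q.sector k ⊆ Q.body := by
  rintro _ ⟨z, ⟨hre, him⟩, rfl⟩
  exact Q.constantWidth.convex.smul_mem_of_zero_mem (mem_of_mem_nhds (Q.body_mem_nhds_zero hr))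
    (Q.arc_mem_body (Set.Ioo_subset_Icc_self him)) (Set.Ioo_subset_Icc_self hre)

theorem body_sdiff_subset (Q : ReuleauxPolygon N) (hr : HasCentredIncircle Q.body r) :
    Q.body \ ⋃ k, Q.sector k ⊆ frontier Q.body ∪ ⋃ k, Set.range fun c : ℝ => c • Q.vertex k := by
  rintro x ⟨hx, hxs⟩
  rcases eq_or_ne x 0 with rfl | hx0
  · exact Or.inr (Set.mem_iUnion.mpr ⟨0, 0, zero_smul ℝ _⟩)
  obtain ⟨y, hy, c, hc, rfl⟩ := exists_mem_frontier_smul_eq Q.constantWidth.convex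
    (Q.body_mem_nhds_zero hr)
    (NormedSpace.isVonNBounded_of_isBounded ℝ Q.constantWidth.isCompact.isBounded) hx hx0
  rcases hc.2.eq_or_lt with rfl | hc1
  · exact Or.inl (by rwa [one_smul])
  right
  rw [Q.frontier_eq] at hy
  obtain ⟨k, t, ht, rfl⟩ := Set.mem_iUnion.mp hy
  rcases ht.1.eq_or_lt with rfl | hα
  · exact Set.mem_iUnion.mpr ⟨k + 1, c, by simp only [Q.vertex_succ]⟩
  rcases ht.2.eq_or_lt with rfl | hβ
  · exact Set.mem_iUnion.mpr ⟨k - 1, c, by simp only [Q.vertex_pred]⟩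
  · exact (hxs (Set.mem_iUnion.mpr ⟨k, ⟨c, t⟩, ⟨⟨hc.1, hc1⟩, hα, hβ⟩, rfl⟩)).elim

theorem volume_body_eq_sum_sector (Q : ReuleauxPolygon N) (hr : HasCentredIncircle Q.body r) :
    volume Q.body = ∑ k, volume (Q.sector k) := by
  have hmeas : ∀ k, MeasurableSet (Q.sector k) := fun k =>
    measurable_image_of_fderivWithin (isOpen_Ioo.reProdIm isOpen_Ioo).measurableSet
      (fun z _ => (hasFDerivAt_coneMap (γ' := fun t => Complex.I * unitVec t)
        ((hasDerivAt_unitVec z.im).const_add _)).hasFDerivWithinAt)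
      (fun z hz w hw h => (Q.eq_and_eq_of_coneMap_eq hr hz hw h).2)
  have hdisj : Pairwise (Function.onFun Disjoint Q.sector) := by
    intro i j hij
    refine Set.disjoint_left.mpr ?_
    rintro _ ⟨z, hz, rfl⟩ ⟨w, hw, h⟩
    exact hij (Q.eq_and_eq_of_coneMap_eq hr hw hz h).1.symm
  have hnull : volume (Q.body \ ⋃ k, Q.sector k) = 0 :=
    measure_mono_null (Q.body_sdiff_subset hr) (measure_union_null
      (Q.constantWidth.convex.addHaar_frontier volume)
      (measure_iUnion_null fun k => volume_range_smul_eq_zero _))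
  rw [← measure_eq_measure_of_null_sdiff (Set.iUnion_subset (Q.sector_subset_body hr)) hnull,
    measure_iUnion hdisj hmeas, tsum_fintype]

theorem areaForm_arc_nonneg (Q : ReuleauxPolygon N) (hr : HasCentredIncircle Q.body r)
    (k : ZMod (2 * N + 1)) (t : ℝ) :
    0 ≤ areaForm (Q.vertex k + unitVec t) (Complex.I * unitVec t) := by
  have hle := (abs_le.mp (abs_real_inner_le_norm (Q.vertex k) (unitVec t))).1
  rw [norm_unitVec, mul_one] at hle
  rw [areaForm_arc]
  linarith [Q.norm_vertex_le hr k, Q.inradius_pos hr.1]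

theorem volume_sector (Q : ReuleauxPolygon N) (hr : HasCentredIncircle Q.body r)
    (k : ZMod (2 * N + 1)) :
    volume (Q.sector k) = ENNReal.ofReal
      ((∫ t in Q.α k..Q.β k, areaForm (Q.vertex k + unitVec t) (Complex.I * unitVec t)) / 2) :=
  volume_coneMap_image (Q.α_lt_β k).le (fun t => (hasDerivAt_unitVec t).const_add _)
    (by fun_prop) (fun t _ => Q.areaForm_arc_nonneg hr k t)
    (fun _ hz _ hw h => (Q.eq_and_eq_of_coneMap_eq hr hz hw h).2)

theorem integral_areaForm_arc_eq (Q : ReuleauxPolygon N) (k : ZMod (2 * N + 1)) :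
    ∫ t in Q.α k..Q.β k, areaForm (Q.vertex k + unitVec t) (Complex.I * unitVec t) =
      Q.β k - Q.α k -
        (areaForm (Q.vertex (k - 1)) (Q.vertex k) + areaForm (Q.vertex k) (Q.vertex (k + 1))) := by
  rw [integral_areaForm_arc, areaForm_swap (Q.vertex (k - 1)), Q.vertex_pred, Q.vertex_succ]
  simp only [map_add, map_sub, areaForm_self]
  ring

theorem volume_body (Q : ReuleauxPolygon N) (hr : HasCentredIncircle Q.body r) :
    volume Q.body = ENNReal.ofReal
      (Real.pi / 2 - ∑ k, areaForm (Q.vertex k) (Q.vertex (k + 1))) := by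
  have hnonneg : ∀ k, 0 ≤
      (∫ t in Q.α k..Q.β k, areaForm (Q.vertex k + unitVec t) (Complex.I * unitVec t)) / 2 :=
    fun k => div_nonneg (intervalIntegral.integral_nonneg (Q.α_lt_β k).le fun t _ =>
      Q.areaForm_arc_nonneg hr k t) zero_le_two
  have hshift : ∑ k, areaForm (Q.vertex (k - 1)) (Q.vertex k) =
      ∑ k, areaForm (Q.vertex k) (Q.vertex (k + 1)) := by
    rw [← Equiv.sum_comp (Equiv.addRight (1 : ZMod (2 * N + 1)))]
    simp
  rw [Q.volume_body_eq_sum_sector hr, Finset.sum_congr rfl fun k _ => Q.volume_sector hr k,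
    ← ENNReal.ofReal_sum_of_nonneg fun k _ => hnonneg k, ← Finset.sum_div]
  simp only [integral_areaForm_arc_eq, Finset.sum_sub_distrib, Finset.sum_add_distrib, hshift]
  rw [← Finset.sum_sub_distrib, Q.isUnitStar.sum_angles Q.vertex_injective]
  congr 1
  ring

end ReuleauxPolygon

/-! ### Three-bar linkages -/

section Linkage

open Filter Topology

theorem areaForm_I_mul_left (z w : ℂ) : areaForm (Complex.I * z) w = -⟪z, w⟫_ℝ := by
  simp only [areaForm_apply, inner_eq_re_add_im, Complex.I_mul_re, Complex.I_mul_im]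
  ring

theorem inner_I_mul_left (z w : ℂ) : ⟪Complex.I * z, w⟫_ℝ = areaForm z w := by
  simp only [areaForm_apply, inner_eq_re_add_im, Complex.I_mul_re, Complex.I_mul_im]
  ring

theorem inner_I_mul_right (z w : ℂ) : ⟪z, Complex.I * w⟫_ℝ = areaForm w z := by
  rw [real_inner_comm, inner_I_mul_left]

theorem sq_areaForm (z w : ℂ) : areaForm z w ^ 2 = ‖z‖ ^ 2 * ‖w‖ ^ 2 - ⟪z, w⟫_ℝ ^ 2 := by
  simp only [← real_inner_self_eq_norm_sq, areaForm_apply, inner_eq_re_add_im]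
  ring

theorem norm_sq_mul_areaForm (z w e : ℂ) :
    ‖e‖ ^ 2 * areaForm z w = areaForm z e * ⟪e, w⟫_ℝ - areaForm w e * ⟪e, z⟫_ℝ := by
  simp only [← real_inner_self_eq_norm_sq, areaForm_apply, inner_eq_re_add_im]
  ring

theorem eq_areaForm_smul_of_inner_eq_zero {v w : ℂ} (hv : ‖v‖ = 1) (hw : ⟪v, w⟫_ℝ = 0) :
    w = areaForm v w • (Complex.I * v) := by
  have hv' := real_inner_self_eq_norm_sq v
  rw [hv, one_pow, inner_eq_re_add_im] at hv'
  rw [inner_eq_re_add_im] at hw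
  apply Complex.ext
  · rw [Complex.smul_re, Complex.I_mul_re, areaForm_apply, smul_eq_mul]
    linear_combination -w.re * hv' + v.re * hw
  · rw [Complex.smul_im, Complex.I_mul_im, areaForm_apply, smul_eq_mul]
    linear_combination -w.im * hv' + v.im * hw

theorem hasDerivAt_areaForm {f g : ℝ → ℂ} {f' g' : ℂ} {t : ℝ} (hf : HasDerivAt f f' t)
    (hg : HasDerivAt g g' t) :
    HasDerivAt (fun s => areaForm (f s) (g s)) (areaForm (f t) g' + areaForm f' (g t)) t :=
  areaForm.hasDerivAt_of_bilinear (fun _ => hf) fun _ => hg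

theorem inner_deriv_eq_zero_of_eventually_norm_eq {E : Type*} [NormedAddCommGroup E]
    [InnerProductSpace ℝ E] {f : ℝ → E} {f' : E} {t c : ℝ} (hf : HasDerivAt f f' t)
    (hc : ∀ᶠ s in 𝓝 t, ‖f s‖ = c) : ⟪f t, f'⟫_ℝ = 0 := by
  have hconst : HasDerivAt (fun s => ‖f s‖ ^ 2) 0 t :=
    (hasDerivAt_const t (c ^ 2)).congr_of_eventuallyEq (hc.mono fun s hs => congrArg (· ^ 2) hs)
  linarith [hf.norm_sq.unique hconst]

section Derivative

variable {F : ℝ → ℝ} {a : ℝ}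

theorem eventually_gt_of_deriv_pos (hc : ContinuousAt F a) (h : ∀ᶠ ε in 𝓝[>] a, 0 < deriv F ε) :
    ∀ᶠ ε in 𝓝[>] a, F a < F ε := by
  obtain ⟨u, hu, hsub⟩ := mem_nhdsGT_iff_exists_Ioo_subset.mp h
  filter_upwards [Ioo_mem_nhdsGT hu] with ε hε
  have hmono : StrictMonoOn F (Set.Icc a ε) := by
    refine strictMonoOn_of_deriv_pos (convex_Icc a ε) (fun s hs => ?_) fun s hs => ?_
    · rcases hs.1.eq_or_lt with rfl | has
      · exact hc.continuousWithinAt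
      · exact (differentiableAt_of_deriv_ne_zero (hsub ⟨has, hs.2.trans_lt hε.2⟩).out.ne')
          |>.continuousAt.continuousWithinAt
    · rw [interior_Icc] at hs
      exact hsub ⟨hs.1, hs.2.trans hε.2⟩
  exact hmono (Set.left_mem_Icc.mpr hε.1.le) (Set.right_mem_Icc.mpr hε.1.le) hε.1

theorem eventually_gt_of_deriv_neg (hc : ContinuousAt F a) (h : ∀ᶠ ε in 𝓝[<] a, deriv F ε < 0) :
    ∀ᶠ ε in 𝓝[<] a, F a < F ε := by
  obtain ⟨u, hu, hsub⟩ := mem_nhdsLT_iff_exists_Ioo_subset.mp h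
  filter_upwards [Ioo_mem_nhdsLT hu] with ε hε
  have hanti : StrictAntiOn F (Set.Icc ε a) := by
    refine strictAntiOn_of_deriv_neg (convex_Icc ε a) (fun s hs => ?_) fun s hs => ?_
    · rcases hs.2.eq_or_lt with rfl | hsa
      · exact hc.continuousWithinAt
      · exact (differentiableAt_of_deriv_ne_zero (hsub ⟨hε.1.trans_le hs.1, hsa⟩).out.ne)
          |>.continuousAt.continuousWithinAt
    · rw [interior_Icc] at hs
      exact hsub ⟨hε.1.trans hs.1, hs.2⟩
  exact hanti (Set.left_mem_Icc.mpr hε.2.le) (Set.right_mem_Icc.mpr hε.2.le) hε.2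

theorem eventually_lt_right_of_deriv_neg (h : deriv F a < 0) : ∀ᶠ ε in 𝓝[>] a, F ε < F a := by
  have hsign := eventually_nhdsWithin_sign_eq_of_deriv_neg
    (f := fun ε => F ε - F a) (by rwa [deriv_sub_const]) (sub_self _)
  filter_upwards [hsign.filter_mono nhdsWithin_le_nhds, self_mem_nhdsWithin] with ε hs hε
  rwa [sign_neg (sub_neg.mpr (Set.mem_Ioi.mp hε)), sign_eq_neg_one_iff, sub_neg] at hs

theorem eventually_gt_left_of_deriv_neg (h : deriv F a < 0) : ∀ᶠ ε in 𝓝[<] a, F a < F ε := by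
  have hsign := eventually_nhdsWithin_sign_eq_of_deriv_neg
    (f := fun ε => F ε - F a) (by rwa [deriv_sub_const]) (sub_self _)
  filter_upwards [hsign.filter_mono nhdsWithin_le_nhds, self_mem_nhdsWithin] with ε hs hε
  rwa [sign_pos (sub_pos.mpr (Set.mem_Iio.mp hε)), sign_eq_one_iff, sub_pos] at hs

end Derivative

/-- The apex of an isosceles triangle with unit legs and base `x b`. Of the two possible points,
this is the one on the right of the line directed from `x` to `b`. -/
noncomputable def linkPoint (b x : ℂ) : ℂ :=
  x + (b - x) * (1 / 2 - √(1 / ‖b - x‖ ^ 2 - 1 / 4) * Complex.I)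

theorem norm_linkPoint {b x : ℂ} (hbx : b ≠ x) (h : ‖b - x‖ ≤ 2) :
    ‖linkPoint b x - x‖ = 1 ∧ ‖linkPoint b x - b‖ = 1 := by
  have hpos : 0 < ‖b - x‖ := norm_pos_iff.mpr (sub_ne_zero.mpr hbx)
  have hroot : 0 ≤ 1 / ‖b - x‖ ^ 2 - 1 / 4 :=
    sub_nonneg.mpr (one_div_le_one_div_of_le (by positivity) (by nlinarith))
  have hsq := Real.sq_sqrt hroot
  set s := √(1 / ‖b - x‖ ^ 2 - 1 / 4) with hs
  have hprod : ‖b - x‖ ^ 2 * (1 / 4 + s ^ 2) = 1 := by rw [hsq]; field_simp; ring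
  have key (z : ℂ) (hz : ‖z‖ ^ 2 = 1 / 4 + s ^ 2) : ‖(b - x) * z‖ = 1 := by
    rw [← pow_eq_one_iff_of_nonneg (norm_nonneg _) two_ne_zero, norm_mul, mul_pow, hz, hprod]
  constructor
  · convert key (1 / 2 - s * Complex.I) ?_ using 2
    · rw [linkPoint, ← hs]; ring
    · rw [Complex.sq_norm, Complex.normSq_apply]
      simp; ring
  · convert key (-1 / 2 - s * Complex.I) ?_ using 2
    · rw [linkPoint, ← hs]; ring
    · rw [Complex.sq_norm, Complex.normSq_apply]
      simp; ring

theorem areaForm_mul_mul (u z w : ℂ) : areaForm (u * z) (u * w) = ‖u‖ ^ 2 * areaForm z w := by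
  simp only [← real_inner_self_eq_norm_sq, areaForm_apply, inner_eq_re_add_im, Complex.mul_re,
    Complex.mul_im]
  ring

theorem linkPoint_eq {b x y : ℂ} (hx : ‖y - x‖ = 1) (hb : ‖y - b‖ = 1)
    (hturn : 0 < areaForm (b - y) (x - y)) : linkPoint b x = y := by
  have hbx : b - x ≠ 0 := fun h => by
    rw [sub_eq_zero.mp h, areaForm_self] at hturn
    exact hturn.false
  have hpos : 0 < ‖b - x‖ ^ 2 := by positivity
  obtain ⟨ζ, hζ⟩ : ∃ ζ : ℂ, (b - x) * ζ = y - x := ⟨(y - x) / (b - x), mul_div_cancel₀ _ hbx⟩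
  obtain rfl : y = x + (b - x) * ζ := by rw [hζ]; ring
  have hζ_norm : ‖b - x‖ ^ 2 * (ζ.re ^ 2 + ζ.im ^ 2) = 1 := by
    have h : ‖b - x‖ ^ 2 * (ζ.re ^ 2 + ζ.im ^ 2) = ‖(b - x) * ζ‖ ^ 2 := by
      rw [norm_mul, mul_pow, Complex.sq_norm ζ, Complex.normSq_apply]; ring
    rw [h, hζ, hx, one_pow]
  have hζ_norm' : ‖b - x‖ ^ 2 * ((ζ.re - 1) ^ 2 + ζ.im ^ 2) = 1 := by
    have h : ‖b - x‖ ^ 2 * ((ζ.re - 1) ^ 2 + ζ.im ^ 2) = ‖(b - x) * (ζ - 1)‖ ^ 2 := by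
      rw [norm_mul, mul_pow, Complex.sq_norm (ζ - 1), Complex.normSq_apply, Complex.sub_re,
        Complex.sub_im, Complex.one_re, Complex.one_im]
      ring
    rw [h, mul_sub, hζ, mul_one, sub_sub_sub_cancel_right, hb, one_pow]
  have hre : ζ.re = 1 / 2 := by
    linarith [mul_left_cancel₀ hpos.ne' (hζ_norm.trans hζ_norm'.symm)]
  have him : ζ.im < 0 := by
    rw [← sub_sub, ← mul_one_sub, sub_add_cancel_left, ← mul_neg, areaForm_mul_mul] at hturn
    have hζ_turn := pos_of_mul_pos_right hturn hpos.le
    simp only [areaForm_apply, Complex.sub_re, Complex.sub_im, Complex.neg_re, Complex.neg_im,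
      Complex.one_re, Complex.one_im] at hζ_turn
    linarith
  have hroot : √(1 / ‖b - x‖ ^ 2 - 1 / 4) = -ζ.im := by
    rw [← Real.sqrt_sq (neg_nonneg.mpr him.le), ← eq_one_div_of_mul_eq_one_right hζ_norm, hre]
    congr 1; ring
  rw [linkPoint, hroot]
  congr 2
  apply Complex.ext <;> simp [hre]

theorem differentiableAt_linkPoint {b : ℂ} {x : ℝ → ℂ} {t : ℝ} (hx : DifferentiableAt ℝ x t)
    (hbx : b ≠ x t) (h : ‖b - x t‖ < 2) : DifferentiableAt ℝ (fun s => linkPoint b (x s)) t := by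
  have hpos : 0 < ‖b - x t‖ := norm_pos_iff.mpr (sub_ne_zero.mpr hbx)
  have hroot : 0 < 1 / ‖b - x t‖ ^ 2 - 1 / 4 :=
    sub_pos.mpr (one_div_lt_one_div_of_lt (by positivity) (by nlinarith))
  have hdiff : DifferentiableAt ℝ (fun s => √(1 / ‖b - x s‖ ^ 2 - 1 / 4)) t :=
    (((differentiableAt_const (1 : ℝ)).div ((hx.const_sub b).norm_sq ℝ)
      (by positivity)).sub_const _).sqrt hroot.ne'
  have hcast : DifferentiableAt ℝ (fun s => ((√(1 / ‖b - x s‖ ^ 2 - 1 / 4) : ℝ) : ℂ)) t :=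
    Complex.ofRealCLM.differentiableAt.comp t hdiff
  unfold linkPoint
  fun_prop

section Velocity

/-! In the next lemmas the bars of the linkage are the unit vectors `f`, `e` and `-v`. The first
joint moves with velocity `I * f`, that is, `f` rotates with unit speed, and the second joint moves
with velocity `w`. -/

variable {e f v w : ℂ}

theorem exists_angular_velocity (hv : ‖v‖ = 1) (hw : ⟪v, w⟫_ℝ = 0)
    (hwe : ⟪e, w - Complex.I * f⟫_ℝ = 0) :
    ∃ ω : ℝ, w = ω • (Complex.I * v) ∧ ω * areaForm v e = areaForm f e := by
  have h := eq_areaForm_smul_of_inner_eq_zero hv hw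
  refine ⟨areaForm v w, h, ?_⟩
  rwa [h, inner_sub_right, inner_smul_right, inner_I_mul_right, inner_I_mul_right, sub_eq_zero]
    at hwe

theorem mul_lt_mul_of_sq_eq {p q S T : ℝ} (hS : 0 < S) (hS2 : S ^ 2 = 2 * p - p ^ 2)
    (hT2 : T ^ 2 = 2 * q - q ^ 2) (hpq : p < q) : p * T < q * S := by
  have hp : 0 < p := by nlinarith
  have hq : 0 < q := hp.trans hpq
  apply lt_of_pow_lt_pow_left₀ 2 (by positivity)
  have hdiff : (q * S) ^ 2 - (p * T) ^ 2 = 2 * (p * q) * (q - p) := by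
    rw [mul_pow, mul_pow, hS2, hT2]; ring
  have := mul_pos (mul_pos two_pos (mul_pos hp hq)) (sub_pos.mpr hpq)
  linarith

theorem areaForm_velocity_mul (hf : ‖f‖ = 1) (hv : ‖v‖ = 1) (hw : ⟪v, w⟫_ℝ = 0)
    (hwe : ⟪e, w - Complex.I * f⟫_ℝ = 0) :
    (areaForm (Complex.I * f) (e + f) + areaForm w (e - v)) * areaForm v e =
      (1 - ⟪e, v⟫_ℝ) * areaForm f e - (1 + ⟪e, f⟫_ℝ) * areaForm v e := by
  obtain ⟨ω, rfl, hω⟩ := exists_angular_velocity hv hw hwe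
  rw [← hω, map_smul, smul_apply, areaForm_I_mul_left, areaForm_I_mul_left,
    inner_add_right, inner_sub_right, real_inner_self_eq_norm_sq, real_inner_self_eq_norm_sq, hf,
    hv, real_inner_comm e f, real_inner_comm e v, smul_eq_mul]
  ring

theorem areaForm_sq_eq_two_mul_sub_sq (he : ‖e‖ = 1) (hf : ‖f‖ = 1) :
    areaForm f e ^ 2 = 2 * (1 + ⟪e, f⟫_ℝ) - (1 + ⟪e, f⟫_ℝ) ^ 2 := by
  rw [sq_areaForm, he, hf, real_inner_comm]; ring

theorem areaForm_velocity_pos (he : ‖e‖ = 1) (hf : ‖f‖ = 1) (hv : ‖v‖ = 1)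
    (hfe : 0 < areaForm f e) (hve : 0 < areaForm v e) (hw : ⟪v, w⟫_ℝ = 0)
    (hwe : ⟪e, w - Complex.I * f⟫_ℝ = 0) (hgap : ⟪e, f + v⟫_ℝ < 0) :
    0 < areaForm (Complex.I * f) (e + f) + areaForm w (e - v) := by
  refine pos_of_mul_pos_left ?_ hve.le
  rw [areaForm_velocity_mul hf hv hw hwe, sub_pos]
  rw [inner_add_right] at hgap
  refine mul_lt_mul_of_sq_eq hfe (areaForm_sq_eq_two_mul_sub_sq he hf) ?_ (by linarith)
  rw [areaForm_sq_eq_two_mul_sub_sq he hv]; ring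

theorem areaForm_velocity_neg (he : ‖e‖ = 1) (hf : ‖f‖ = 1) (hv : ‖v‖ = 1)
    (hve : 0 < areaForm v e) (hw : ⟪v, w⟫_ℝ = 0)
    (hwe : ⟪e, w - Complex.I * f⟫_ℝ = 0) (hgap : 0 < ⟪e, f + v⟫_ℝ) :
    areaForm (Complex.I * f) (e + f) + areaForm w (e - v) < 0 := by
  refine neg_of_mul_neg_left ?_ hve.le
  rw [areaForm_velocity_mul hf hv hw hwe, sub_neg]
  rw [inner_add_right] at hgap
  refine mul_lt_mul_of_sq_eq hve ?_ (areaForm_sq_eq_two_mul_sub_sq he hf) (by linarith)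
  rw [areaForm_sq_eq_two_mul_sub_sq he hv]; ring

theorem gap_velocity_neg (he : ‖e‖ = 1) (hf : ‖f‖ = 1) (hv : ‖v‖ = 1)
    (hfe : 0 < areaForm f e) (hve : 0 < areaForm v e) (hw : ⟪v, w⟫_ℝ = 0)
    (hwe : ⟪e, w - Complex.I * f⟫_ℝ = 0) (hgap : ⟪e, f + v⟫_ℝ = 0) (hef : ‖e + f‖ < 1) :
    ⟪e, Complex.I * f + w⟫_ℝ + ⟪w - Complex.I * f, f + v⟫_ℝ < 0 := by
  rw [inner_add_right] at hgap
  have hv_eq : ⟪e, v⟫_ℝ = -⟪e, f⟫_ℝ := by linarith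
  have harea : areaForm v e = areaForm f e := by
    refine (pow_left_inj₀ hve.le hfe.le two_ne_zero).mp ?_
    rw [areaForm_sq_eq_two_mul_sub_sq he hv, areaForm_sq_eq_two_mul_sub_sq he hf, hv_eq]; ring
  obtain ⟨ω, rfl, hω⟩ := exists_angular_velocity hv hw hwe
  obtain rfl : ω = 1 := by rwa [harea, mul_eq_right₀ hfe.ne'] at hω
  have hvf : areaForm v f = 2 * (areaForm f e * ⟪e, f⟫_ℝ) := by
    have h := norm_sq_mul_areaForm v f e
    rw [he, one_pow, one_mul, harea, hv_eq] at h
    rw [h]; ring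
  have hinner : ⟪e, f⟫_ℝ < -(1 / 2) := by
    have h := norm_add_sq_real e f
    rw [he, hf] at h
    nlinarith [norm_nonneg (e + f)]
  rw [one_smul, inner_sub_left, inner_add_right, inner_add_right, inner_add_right,
    inner_I_mul_right, inner_I_mul_right, inner_I_mul_left, inner_I_mul_left, inner_I_mul_left,
    inner_I_mul_left, areaForm_self, areaForm_self, areaForm_swap f v, hvf, harea]
  nlinarith

end Velocity

/-- A family of chains `a`, `x ε`, `y ε`, `b` of three unit segments with fixed ends, such that the
first segment rotates with unit speed and both turns of the chain are to the left at `ε = 0`. -/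
structure IsLinkage (a b : ℂ) (x y : ℝ → ℂ) : Prop where
  hasDerivAt_left : ∀ ε, HasDerivAt x (Complex.I * (x ε - a)) ε
  norm_left : ∀ ε, ‖x ε - a‖ = 1
  differentiableAt : ∀ᶠ ε in 𝓝 (0 : ℝ), DifferentiableAt ℝ y ε
  norm_mid : ∀ᶠ ε in 𝓝 (0 : ℝ), ‖y ε - x ε‖ = 1
  norm_right : ∀ᶠ ε in 𝓝 (0 : ℝ), ‖y ε - b‖ = 1
  turn_left : 0 < areaForm (x 0 - a) (y 0 - x 0)
  turn_right : 0 < areaForm (y 0 - b) (y 0 - x 0)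

theorem isLinkage_linkPoint {a b y₀ : ℂ} {τ : ℝ} (hmid : ‖y₀ - (a + unitVec τ)‖ = 1)
    (hright : ‖y₀ - b‖ = 1) (hturn_left : 0 < areaForm (unitVec τ) (y₀ - (a + unitVec τ)))
    (hturn_right : 0 < areaForm (y₀ - b) (y₀ - (a + unitVec τ)))
    (hdist : ‖b - (a + unitVec τ)‖ < 2) :
    IsLinkage a b (fun ε => a + unitVec (τ + ε)) (fun ε => linkPoint b (a + unitVec (τ + ε))) := by
  set x : ℝ → ℂ := fun ε => a + unitVec (τ + ε) with hx
  have hx0 : x 0 = a + unitVec τ := by simp only [hx, add_zero]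
  have hder (ε : ℝ) : HasDerivAt x (Complex.I * (x ε - a)) ε := by
    rw [hx, add_sub_cancel_left]
    exact ((hasDerivAt_unitVec (τ + ε)).comp_const_add τ ε).const_add a
  have hcont : ContinuousAt x 0 := (hder 0).continuousAt
  have hy0 : linkPoint b (x 0) = y₀ := by
    rw [hx0]
    refine linkPoint_eq hmid hright ?_
    rwa [← neg_sub y₀ b, ← neg_sub y₀ (a + _), map_neg, map_neg, neg_apply, neg_neg]
  have hbx : b ≠ x 0 := by
    rintro rfl
    rw [hx0, areaForm_self] at hturn_right
    exact hturn_right.false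
  have hcont_norm : ContinuousAt (fun ε => ‖b - x ε‖) 0 := by fun_prop
  have hev : ∀ᶠ ε in 𝓝 (0 : ℝ), b ≠ x ε ∧ ‖b - x ε‖ < 2 :=
    ((hcont.eventually_ne hbx.symm).mono fun _ => Ne.symm).and
      (hcont_norm.eventually_lt_const (by simpa only [hx0] using hdist))
  refine ⟨hder, fun ε => by rw [hx, add_sub_cancel_left, norm_unitVec],
    hev.mono fun ε h => differentiableAt_linkPoint (hder ε).differentiableAt h.1 h.2,
    hev.mono fun ε h => (norm_linkPoint h.1 h.2.le).1,
    hev.mono fun ε h => (norm_linkPoint h.1 h.2.le).2, ?_, ?_⟩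
  · rwa [hy0, hx0, add_sub_cancel_left]
  · rwa [hy0, hx0]

namespace IsLinkage

variable {a b : ℂ} {x y : ℝ → ℂ}

theorem continuousAt_left (h : IsLinkage a b x y) : ContinuousAt x 0 :=
  (h.hasDerivAt_left 0).continuousAt

theorem continuousAt_right (h : IsLinkage a b x y) : ContinuousAt y 0 :=
  h.differentiableAt.self_of_nhds.continuousAt

/-- Twice the signed area of the polygon `0`, `a`, `x ε`, `y ε`, `b`. -/
noncomputable def crossSum (a b : ℂ) (x y : ℝ → ℂ) (ε : ℝ) : ℝ :=
  areaForm a (x ε) + areaForm (x ε) (y ε) + areaForm (y ε) b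

/-- Half the difference of the squares of `‖y ε - a‖` and `‖x ε - b‖`: its sign tells which of the
two angles of the chain is larger. -/
noncomputable def angleGap (a b : ℂ) (x y : ℝ → ℂ) (ε : ℝ) : ℝ :=
  ⟪y ε - x ε, (x ε - a) + (y ε - b)⟫_ℝ

theorem eventually_velocity (h : IsLinkage a b x y) : ∀ᶠ ε in 𝓝 (0 : ℝ),
    ⟪y ε - b, deriv y ε⟫_ℝ = 0 ∧
    ⟪y ε - x ε, deriv y ε - Complex.I * (x ε - a)⟫_ℝ = 0 := by
  filter_upwards [h.differentiableAt, h.norm_mid.eventually_nhds, h.norm_right.eventually_nhds]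
    with ε hd hm hr
  have hright : HasDerivAt (fun s => y s - b) (deriv y ε) ε := hd.hasDerivAt.sub_const b
  have hmid : HasDerivAt (fun s => y s - x s) (deriv y ε - Complex.I * (x ε - a)) ε :=
    hd.hasDerivAt.sub (h.hasDerivAt_left ε)
  have hright_zero := inner_deriv_eq_zero_of_eventually_norm_eq hright hr
  have hmid_zero := inner_deriv_eq_zero_of_eventually_norm_eq hmid hm
  exact ⟨hright_zero, hmid_zero⟩

theorem eventually_turn (h : IsLinkage a b x y) : ∀ᶠ ε in 𝓝 (0 : ℝ),
    0 < areaForm (x ε - a) (y ε - x ε) ∧ 0 < areaForm (y ε - b) (y ε - x ε) := by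
  have hx := h.continuousAt_left
  have hy := h.continuousAt_right
  have hl : ContinuousAt (fun ε => areaForm (x ε - a) (y ε - x ε)) 0 := by fun_prop
  have hr : ContinuousAt (fun ε => areaForm (y ε - b) (y ε - x ε)) 0 := by fun_prop
  exact (hl.eventually_const_lt h.turn_left).and (hr.eventually_const_lt h.turn_right)

theorem eventually_hasDerivAt_crossSum (h : IsLinkage a b x y) : ∀ᶠ ε in 𝓝 (0 : ℝ),
    HasDerivAt (crossSum a b x y)
      (areaForm (Complex.I * (x ε - a)) ((y ε - x ε) + (x ε - a)) +
        areaForm (deriv y ε) ((y ε - x ε) - (y ε - b))) ε := by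
  filter_upwards [h.differentiableAt] with ε hd
  have hx := h.hasDerivAt_left ε
  refine (((hasDerivAt_areaForm (hasDerivAt_const ε a) hx).add
    (hasDerivAt_areaForm hx hd.hasDerivAt)).add
    (hasDerivAt_areaForm hd.hasDerivAt (hasDerivAt_const ε b))).congr_deriv ?_
  rw [sub_add_sub_cancel, sub_sub_sub_cancel_left, map_sub, map_sub, map_zero, map_zero, zero_apply,
    areaForm_swap (x ε) (deriv y ε), areaForm_swap a]
  ring

theorem eventually_deriv_crossSum_pos (h : IsLinkage a b x y) : ∀ᶠ ε in 𝓝 (0 : ℝ),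
    angleGap a b x y ε < 0 → 0 < deriv (crossSum a b x y) ε := by
  filter_upwards [h.norm_mid, h.norm_right, h.eventually_velocity, h.eventually_turn,
    h.eventually_hasDerivAt_crossSum] with ε hm hr hvel hturn hder hgap
  rw [hder.deriv]
  exact areaForm_velocity_pos hm (h.norm_left ε) hr hturn.1 hturn.2 hvel.1 hvel.2 hgap

theorem eventually_deriv_crossSum_neg (h : IsLinkage a b x y) : ∀ᶠ ε in 𝓝 (0 : ℝ),
    0 < angleGap a b x y ε → deriv (crossSum a b x y) ε < 0 := by
  filter_upwards [h.norm_mid, h.norm_right, h.eventually_velocity, h.eventually_turn,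
    h.eventually_hasDerivAt_crossSum] with ε hm hr hvel hturn hder hgap
  rw [hder.deriv]
  exact areaForm_velocity_neg hm (h.norm_left ε) hr hturn.2 hvel.1 hvel.2 hgap

theorem hasDerivAt_angleGap (h : IsLinkage a b x y) : HasDerivAt (angleGap a b x y)
    (⟪y 0 - x 0, Complex.I * (x 0 - a) + deriv y 0⟫_ℝ +
      ⟪deriv y 0 - Complex.I * (x 0 - a), (x 0 - a) + (y 0 - b)⟫_ℝ) 0 := by
  have hx := h.hasDerivAt_left 0
  have hy := h.differentiableAt.self_of_nhds.hasDerivAt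
  exact (hy.sub hx).inner ℝ ((hx.sub_const a).add (hy.sub_const b))

/-- Where the two angles of the chain coincide, they vary in opposite directions. -/
theorem deriv_angleGap_neg (h : IsLinkage a b x y) (hgap : angleGap a b x y 0 = 0)
    (hlt : ‖y 0 - a‖ < 1) : deriv (angleGap a b x y) 0 < 0 := by
  rw [h.hasDerivAt_angleGap.deriv]
  have hvel := h.eventually_velocity.self_of_nhds
  exact gap_velocity_neg h.norm_mid.self_of_nhds (h.norm_left 0) h.norm_right.self_of_nhds
    h.turn_left h.turn_right hvel.1 hvel.2 hgap (by rwa [sub_add_sub_cancel])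

theorem continuousAt_crossSum (h : IsLinkage a b x y) : ContinuousAt (crossSum a b x y) 0 :=
  h.eventually_hasDerivAt_crossSum.self_of_nhds.continuousAt

theorem eventually_crossSum_lt_right (h : IsLinkage a b x y) (hgap : angleGap a b x y 0 ≤ 0)
    (hlt : ‖y 0 - a‖ < 1) :
    ∀ᶠ ε in 𝓝[>] (0 : ℝ), crossSum a b x y 0 < crossSum a b x y ε := by
  have hneg : ∀ᶠ ε in 𝓝[>] (0 : ℝ), angleGap a b x y ε < 0 := by
    rcases hgap.lt_or_eq with h0 | h0
    · exact (h.hasDerivAt_angleGap.continuousAt.eventually_lt_const h0).filter_mono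
        nhdsWithin_le_nhds
    · filter_upwards [eventually_lt_right_of_deriv_neg (h.deriv_angleGap_neg h0 hlt)] with ε hε
      exact hε.trans_eq h0
  refine eventually_gt_of_deriv_pos h.continuousAt_crossSum ?_
  filter_upwards [hneg, h.eventually_deriv_crossSum_pos.filter_mono nhdsWithin_le_nhds]
    with ε hε hpos using hpos hε

theorem eventually_crossSum_lt_left (h : IsLinkage a b x y) (hgap : 0 ≤ angleGap a b x y 0)
    (hlt : ‖y 0 - a‖ < 1) :
    ∀ᶠ ε in 𝓝[<] (0 : ℝ), crossSum a b x y 0 < crossSum a b x y ε := by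
  have hpos : ∀ᶠ ε in 𝓝[<] (0 : ℝ), 0 < angleGap a b x y ε := by
    rcases hgap.lt_or_eq' with h0 | h0
    · exact (h.hasDerivAt_angleGap.continuousAt.eventually_const_lt h0).filter_mono
        nhdsWithin_le_nhds
    · filter_upwards [eventually_gt_left_of_deriv_neg (h.deriv_angleGap_neg h0 hlt)] with ε hε
      exact h0.symm.trans_lt hε
  refine eventually_gt_of_deriv_neg h.continuousAt_crossSum ?_
  filter_upwards [hpos, h.eventually_deriv_crossSum_neg.filter_mono nhdsWithin_le_nhds]
    with ε hε hneg using hneg hε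

theorem eventually_norm_left_lt (h : IsLinkage a b x y) (ha : areaForm (x 0) a < 0) :
    ∀ᶠ ε in 𝓝[>] (0 : ℝ), ‖x ε‖ < ‖x 0‖ := by
  have hder : deriv (fun ε => ‖x ε‖ ^ 2) 0 < 0 := by
    rw [(h.hasDerivAt_left 0).norm_sq.deriv, inner_I_mul_right, map_sub, sub_apply,
      areaForm_self, areaForm_swap a]
    linarith
  filter_upwards [eventually_lt_right_of_deriv_neg hder] with ε hε
  exact lt_of_pow_lt_pow_left₀ 2 (norm_nonneg _) hε

theorem eventually_norm_right_lt (h : IsLinkage a b x y) (hb : 0 < areaForm (y 0) b) :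
    ∀ᶠ ε in 𝓝[<] (0 : ℝ), ‖y ε‖ < ‖y 0‖ := by
  have hvel := h.eventually_velocity.self_of_nhds
  obtain ⟨ω, hω, hω_turn⟩ :=
    exists_angular_velocity h.norm_right.self_of_nhds hvel.1 hvel.2
  have hωpos : 0 < ω := pos_of_mul_pos_left (hω_turn ▸ h.turn_left) h.turn_right.le
  have hder : deriv (fun ε => -‖y ε‖ ^ 2) 0 < 0 := by
    rw [h.differentiableAt.self_of_nhds.hasDerivAt.norm_sq.fun_neg.deriv, hω, inner_smul_right,
      inner_I_mul_right, map_sub, sub_apply, areaForm_self, areaForm_swap b]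
    linarith [mul_pos hωpos hb]
  filter_upwards [eventually_gt_left_of_deriv_neg hder] with ε hε
  exact lt_of_pow_lt_pow_left₀ 2 (norm_nonneg _) (neg_lt_neg_iff.mp hε)

end IsLinkage

end Linkage

/-! ### Blaschke deformations -/

theorem zmod_natCast_ne_zero {n m : ℕ} (hm : 0 < m) (hmn : m < n) : (m : ZMod n) ≠ 0 := by
  rw [Ne, ZMod.natCast_eq_zero_iff]
  exact Nat.not_dvd_of_pos_of_lt hm hmn

theorem sum_sub_sum_of_eq_off_triple {n : ℕ} [NeZero n] (hn : 3 ≤ n) {k : ZMod n} {f g : ZMod n → ℝ}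
    (h : ∀ j ∉ labelTriple k, f j = g j) :
    ∑ j, f j - ∑ j, g j = (f (k - 1) + f k + f (k + 1)) - (g (k - 1) + g k + g (k + 1)) := by
  have hone : (1 : ZMod n) ≠ 0 := by exact_mod_cast zmod_natCast_ne_zero one_pos (by omega)
  have htwo : (2 : ZMod n) ≠ 0 := by exact_mod_cast zmod_natCast_ne_zero two_pos (by omega)
  have hpred : k - 1 ≠ k + 1 := fun h => htwo (by linear_combination -h)
  rw [← Finset.sum_sub_distrib, ← Finset.sum_subset (Finset.subset_univ (labelTriple k))
    fun j _ hj => sub_eq_zero.mpr (h j hj), labelTriple, Finset.sum_insert (by simp [hone, hpred]),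
    Finset.sum_insert (by simp [hone]), Finset.sum_singleton]
  ring

namespace ReuleauxPolygon

variable {N : ℕ} {r : ℝ}

theorem areaForm_vertex_pos (Q : ReuleauxPolygon N) (k : ZMod (2 * N + 1)) :
    0 < areaForm (Q.vertex (k + 1) - Q.vertex k) (Q.vertex (k - 1) - Q.vertex k) := by
  rw [Q.vertex_succ, Q.vertex_pred, add_sub_cancel_left, add_sub_cancel_left, areaForm_unitVec]
  exact Real.sin_pos_of_pos_of_lt_pi (by linarith [Q.α_lt_β k])
    (by linarith [Q.isUnitStar.lt_add_pi k])

theorem norm_vertex_succ_sub (Q : ReuleauxPolygon N) (k : ZMod (2 * N + 1)) :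
    ‖Q.vertex (k + 1) - Q.vertex k‖ = 1 := by
  rw [Q.vertex_succ, add_sub_cancel_left, norm_unitVec]

theorem vertex_eq_add (Q : ReuleauxPolygon N) (k : ZMod (2 * N + 1)) :
    Q.vertex k = Q.vertex (k - 1) + unitVec (Q.α (k - 1)) := by
  rw [← Q.vertex_succ, sub_add_cancel]

theorem three_le (Q : ReuleauxPolygon N) : 3 ≤ 2 * N + 1 := by
  rcases Nat.eq_zero_or_pos N with rfl | hN
  · have hlink := Q.norm_vertex_succ_sub 0
    rw [Subsingleton.elim (α := ZMod 1) (0 + 1) 0, sub_self, norm_zero] at hlink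
    exact absurd hlink zero_ne_one
  · omega

theorem add_one_ne (Q : ReuleauxPolygon N) (k : ZMod (2 * N + 1)) : k + 1 ≠ k := by
  have hone : (1 : ZMod (2 * N + 1)) ≠ 0 := by
    exact_mod_cast zmod_natCast_ne_zero one_pos (by linarith [Q.three_le])
  simpa using hone

theorem add_two_ne (Q : ReuleauxPolygon N) (k : ZMod (2 * N + 1)) : k + 2 ≠ k := by
  have htwo : (2 : ZMod (2 * N + 1)) ≠ 0 := by
    exact_mod_cast zmod_natCast_ne_zero two_pos (by linarith [Q.three_le])
  simpa using htwo

/-- The position of the vertex `P k` under the Blaschke deformation of parameter `ε` acting on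
it. -/
noncomputable def movedVertex (Q : ReuleauxPolygon N) (k : ZMod (2 * N + 1)) (ε : ℝ) : ℂ :=
  Q.vertex (k - 1) + unitVec (Q.α (k - 1) + ε)

/-- The position of the vertex `P (k + 1)` under the Blaschke deformation of parameter `ε` acting
on `P k`. -/
noncomputable def movedSucc (Q : ReuleauxPolygon N) (k : ZMod (2 * N + 1)) (ε : ℝ) : ℂ :=
  linkPoint (Q.vertex (k + 2)) (Q.movedVertex k ε)

/-- The vertices after the Blaschke deformation of parameter `ε` acting on `P k`. -/
noncomputable def deformedVertex (Q : ReuleauxPolygon N) (k : ZMod (2 * N + 1)) (ε : ℝ) :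
    ZMod (2 * N + 1) → ℂ :=
  Function.update (Function.update Q.vertex (k + 1) (Q.movedSucc k ε)) k (Q.movedVertex k ε)

section Deformation

variable (Q : ReuleauxPolygon N) (k : ZMod (2 * N + 1))

theorem norm_vertex_succ_sub_add_two : ‖Q.vertex (k + 1) - Q.vertex (k + 2)‖ = 1 := by
  rw [norm_sub_rev, show k + 2 = k + 1 + 1 by ring]
  exact Q.norm_vertex_succ_sub (k + 1)

theorem areaForm_vertex_succ_pos :
    0 < areaForm (Q.vertex (k + 1) - Q.vertex (k + 2)) (Q.vertex (k + 1) - Q.vertex k) := by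
  have hturn := Q.areaForm_vertex_pos (k + 1)
  rw [add_sub_cancel_right, show k + 1 + 1 = k + 2 by ring] at hturn
  rwa [← neg_sub (Q.vertex (k + 2)), ← neg_sub (Q.vertex k), map_neg, map_neg, neg_apply, neg_neg]

theorem movedVertex_zero : Q.movedVertex k 0 = Q.vertex k := by
  rw [movedVertex, add_zero, ← vertex_eq_add]

theorem movedSucc_zero : Q.movedSucc k 0 = Q.vertex (k + 1) := by
  rw [movedSucc, movedVertex_zero]
  refine linkPoint_eq (Q.norm_vertex_succ_sub k) (Q.norm_vertex_succ_sub_add_two k) ?_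
  have hturn := Q.areaForm_vertex_pos (k + 1)
  rwa [add_sub_cancel_right, show k + 1 + 1 = k + 2 by ring] at hturn

theorem isLinkage :
    IsLinkage (Q.vertex (k - 1)) (Q.vertex (k + 2)) (Q.movedVertex k) (Q.movedSucc k) := by
  have hturn := Q.areaForm_vertex_pos k
  rw [areaForm_swap, ← neg_apply, ← map_neg, neg_sub] at hturn
  refine isLinkage_linkPoint (y₀ := Q.vertex (k + 1)) ?_ (Q.norm_vertex_succ_sub_add_two k) ?_ ?_ ?_
  · rw [← vertex_eq_add]
    exact Q.norm_vertex_succ_sub k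
  · rwa [← vertex_eq_add, ← add_sub_cancel_left (Q.vertex (k - 1)) (unitVec _), ← vertex_eq_add]
  · rw [← vertex_eq_add]
    exact Q.areaForm_vertex_succ_pos k
  · rw [← vertex_eq_add]
    exact (Q.isUnitStar.norm_sub_le _ _).trans_lt one_lt_two

theorem deformedVertex_self (ε : ℝ) : Q.deformedVertex k ε k = Q.movedVertex k ε :=
  Function.update_self ..

theorem deformedVertex_succ (ε : ℝ) : Q.deformedVertex k ε (k + 1) = Q.movedSucc k ε := by
  rw [deformedVertex, Function.update_of_ne (Q.add_one_ne k), Function.update_self]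

theorem deformedVertex_zero : Q.deformedVertex k 0 = Q.vertex := by
  rw [deformedVertex, movedSucc_zero, Function.update_eq_self, movedVertex_zero,
    Function.update_eq_self]

variable {k}

theorem deformedVertex_of_ne {j : ZMod (2 * N + 1)} (hj : j ≠ k) (hj_succ : j ≠ k + 1) (ε : ℝ) :
    Q.deformedVertex k ε j = Q.vertex j := by
  rw [deformedVertex, Function.update_of_ne hj, Function.update_of_ne hj_succ]

theorem deformedVertex_pred (ε : ℝ) : Q.deformedVertex k ε (k - 1) = Q.vertex (k - 1) :=
  Q.deformedVertex_of_ne (fun h => Q.add_one_ne k (by linear_combination -h))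
    (fun h => Q.add_two_ne k (by linear_combination -h)) ε

theorem deformedVertex_add_two (ε : ℝ) : Q.deformedVertex k ε (k + 2) = Q.vertex (k + 2) :=
  Q.deformedVertex_of_ne (Q.add_two_ne k) (fun h => Q.add_one_ne k (by linear_combination h)) ε

theorem sum_areaForm_deformedVertex_sub (ε : ℝ) :
    ∑ j, areaForm (Q.deformedVertex k ε j) (Q.deformedVertex k ε (j + 1)) -
      ∑ j, areaForm (Q.vertex j) (Q.vertex (j + 1)) =
    IsLinkage.crossSum (Q.vertex (k - 1)) (Q.vertex (k + 2)) (Q.movedVertex k) (Q.movedSucc k) ε -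
      IsLinkage.crossSum (Q.vertex (k - 1)) (Q.vertex (k + 2)) (Q.movedVertex k)
        (Q.movedSucc k) 0 := by
  rw [sum_sub_sum_of_eq_off_triple Q.three_le (k := k), sub_add_cancel,
    show k + 1 + 1 = k + 2 by ring, deformedVertex_pred, deformedVertex_self, deformedVertex_succ,
    deformedVertex_add_two, IsLinkage.crossSum, IsLinkage.crossSum, movedVertex_zero,
    movedSucc_zero]
  intro j hj
  simp only [labelTriple, Finset.mem_insert, Finset.mem_singleton, not_or] at hj
  obtain ⟨hpred, hself, hsucc⟩ := hj
  rw [Q.deformedVertex_of_ne hself hsucc, Q.deformedVertex_of_ne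
    (fun h => hpred (eq_sub_of_add_eq h)) (fun h => hself (add_right_cancel h))]

theorem continuousAt_deformedVertex (j : ZMod (2 * N + 1)) :
    ContinuousAt (fun ε => Q.deformedVertex k ε j) 0 :=
  continuousAt_pi.mp ((continuousAt_const.update (k + 1) (Q.isLinkage k).continuousAt_right).update
    k (Q.isLinkage k).continuousAt_left) j

open Filter Topology

theorem eventually_norm_deformedVertex_succ_sub :
    ∀ᶠ ε in 𝓝 (0 : ℝ), ∀ j, ‖Q.deformedVertex k ε (j + 1) - Q.deformedVertex k ε j‖ = 1 := by
  filter_upwards [(Q.isLinkage k).norm_mid, (Q.isLinkage k).norm_right] with ε hmid hright j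
  by_cases hself : j = k
  · rw [hself, deformedVertex_self, deformedVertex_succ, hmid]
  by_cases hsucc : j = k + 1
  · rw [hsucc, show k + 1 + 1 = k + 2 by ring, deformedVertex_succ, deformedVertex_add_two,
      norm_sub_rev, hright]
  by_cases hpred : j = k - 1
  · rw [hpred, sub_add_cancel, deformedVertex_self, deformedVertex_pred,
      (Q.isLinkage k).norm_left ε]
  · rw [Q.deformedVertex_of_ne hself hsucc, Q.deformedVertex_of_ne
      (fun h => hpred (eq_sub_of_add_eq h)) (fun h => hself (add_right_cancel h)),
      Q.norm_vertex_succ_sub]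

theorem eventually_injective_deformedVertex :
    ∀ᶠ ε in 𝓝 (0 : ℝ), Function.Injective (Q.deformedVertex k ε) := by
  have hne : ∀ᶠ ε in 𝓝 (0 : ℝ), ∀ i j, i ≠ j → Q.deformedVertex k ε i ≠ Q.deformedVertex k ε j := by
    simp only [eventually_all]
    intro i j hij
    refine ((Q.continuousAt_deformedVertex i).ne_iff_eventually_ne
      (Q.continuousAt_deformedVertex j)).mp ?_
    rw [deformedVertex_zero]
    exact Q.vertex_injective.ne hij
  exact hne.mono fun ε h i j => not_imp_not.mp (h i j)

theorem eventually_norm_deformedVertex_sub_le :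
    ∀ᶠ ε in 𝓝 (0 : ℝ), ∀ i j, ‖Q.deformedVertex k ε i - Q.deformedVertex k ε j‖ ≤ 1 := by
  have hlt : ∀ᶠ ε in 𝓝 (0 : ℝ), ∀ i j, i ≠ j + 1 → j ≠ i + 1 →
      ‖Q.deformedVertex k ε i - Q.deformedVertex k ε j‖ < 1 := by
    simp only [eventually_all]
    intro i j hij hji
    refine ((Q.continuousAt_deformedVertex i).sub
      (Q.continuousAt_deformedVertex j)).norm.eventually_lt_const ?_
    simpa only [Pi.sub_apply, deformedVertex_zero] using Q.norm_vertex_sub_lt_one hij hji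
  filter_upwards [Q.eventually_norm_deformedVertex_succ_sub, hlt] with ε hlink hlt i j
  by_cases hij : i = j + 1
  · rw [hij, hlink]
  by_cases hji : j = i + 1
  · rw [hji, norm_sub_rev, hlink]
  · exact (hlt i j hij hji).le

theorem eventually_areaForm_deformedVertex_pos :
    ∀ᶠ ε in 𝓝 (0 : ℝ), ∀ j, 0 < areaForm (Q.deformedVertex k ε (j + 1) - Q.deformedVertex k ε j)
      (Q.deformedVertex k ε (j - 1) - Q.deformedVertex k ε j) := by
  rw [eventually_all]
  intro j
  have hcont : ContinuousAt (fun ε =>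
      areaForm (Q.deformedVertex k ε (j + 1) - Q.deformedVertex k ε j)
        (Q.deformedVertex k ε (j - 1) - Q.deformedVertex k ε j)) 0 := by
    have := Q.continuousAt_deformedVertex (k := k)
    fun_prop
  refine hcont.eventually_const_lt ?_
  simpa only [deformedVertex_zero] using Q.areaForm_vertex_pos j

theorem eventually_exists_polygon (hr : 0 < r) :
    ∀ᶠ ε in 𝓝 (0 : ℝ), (∀ j, ‖Q.deformedVertex k ε j‖ ≤ 1 - r) →
      ∃ Q' : ReuleauxPolygon N, Q'.vertex = Q.deformedVertex k ε := by
  filter_upwards [Q.eventually_injective_deformedVertex, Q.eventually_norm_deformedVertex_succ_sub,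
    Q.eventually_norm_deformedVertex_sub_le, Q.eventually_areaForm_deformedVertex_pos]
    with ε hinj hlink hdist hturn hnorm
  exact exists_of_vertices hinj hlink hdist hturn hr hnorm

theorem norm_deformedVertex_le (hr : HasCentredIncircle Q.body r) {ε : ℝ}
    (hx : ‖Q.movedVertex k ε‖ ≤ 1 - r) (hy : ‖Q.movedSucc k ε‖ ≤ 1 - r) (j : ZMod (2 * N + 1)) :
    ‖Q.deformedVertex k ε j‖ ≤ 1 - r := by
  by_cases hself : j = k
  · rwa [hself, deformedVertex_self]
  by_cases hsucc : j = k + 1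
  · rwa [hsucc, deformedVertex_succ]
  · rw [Q.deformedVertex_of_ne hself hsucc]
    exact Q.norm_vertex_le hr j

end Deformation

theorem volume_body_lt_volume_body {Q Q' : ReuleauxPolygon N} (hr : HasCentredIncircle Q.body r)
    (hr' : HasCentredIncircle Q'.body r)
    (h : ∑ k, areaForm (Q.vertex k) (Q.vertex (k + 1)) <
      ∑ k, areaForm (Q'.vertex k) (Q'.vertex (k + 1))) :
    volume Q'.body < volume Q.body := by
  have hpos : 0 < volume Q.body :=
    (isOpen_interior.measure_pos volume Q.constantWidth.interior_nonempty).trans_le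
      (measure_mono interior_subset)
  rw [Q.volume_body hr, ENNReal.ofReal_pos] at hpos
  rw [Q.volume_body hr, Q'.volume_body hr', ENNReal.ofReal_lt_ofReal_iff hpos]
  linarith

open Filter Topology in
/-- The vertices that do not move keep the incircle in place. -/
theorem not_isRigid_of_eventually_lt_crossSum (Q : ReuleauxPolygon N)
    (hr : HasCentredIncircle Q.body r) {k : ZMod (2 * N + 1)} {l : Filter ℝ} [l.NeBot]
    (hl : l ≤ 𝓝 0) (hx : ∀ᶠ ε in l, ‖Q.movedVertex k ε‖ ≤ 1 - r)
    (hy : ∀ᶠ ε in l, ‖Q.movedSucc k ε‖ ≤ 1 - r)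
    (harea : ∀ᶠ ε in l,
      IsLinkage.crossSum (Q.vertex (k - 1)) (Q.vertex (k + 2)) (Q.movedVertex k) (Q.movedSucc k) 0 <
      IsLinkage.crossSum (Q.vertex (k - 1)) (Q.vertex (k + 2)) (Q.movedVertex k) (Q.movedSucc k) ε)
    (hzero : (0 : ℂ) ∈ convexHull ℝ
      (Q.vertex '' {j | ‖Q.vertex j‖ = 1 - r ∧ j ≠ k ∧ j ≠ k + 1})) : ¬ Q.IsRigid r := by
  rintro ⟨δ, hδ, hrigid⟩
  have hpos := Q.inradius_pos hr.1
  have hsmall : ∀ᶠ ε in 𝓝 (0 : ℝ), |ε| < δ :=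
    continuous_abs.continuousAt.eventually_lt_const (by simpa only [abs_zero] using hδ)
  obtain ⟨ε, hεδ, hpoly, hxε, hyε, hareaε⟩ := ((hsmall.filter_mono hl).and
    (((Q.eventually_exists_polygon hpos).filter_mono hl).and (hx.and (hy.and harea)))).exists
  have hnorm := Q.norm_deformedVertex_le hr hxε hyε
  obtain ⟨Q', hQ'⟩ := hpoly hnorm
  have hr' : HasCentredIncircle Q'.body r := by
    rw [Q'.hasCentredIncircle_iff hpos, hQ']
    refine ⟨hnorm, convexHull_mono ?_ hzero⟩
    rintro _ ⟨j, ⟨hj, hself, hsucc⟩, rfl⟩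
    have hfix := Q.deformedVertex_of_ne hself hsucc ε
    exact ⟨j, by rwa [Set.mem_ofPred_eq, hfix], hfix⟩
  refine hrigid k ε Q' hεδ ⟨?_, fun j hself hsucc => ?_⟩ hr'
    (volume_body_lt_volume_body hr hr' ?_)
  · rw [hQ', deformedVertex_self, movedVertex]
  · rw [hQ', Q.deformedVertex_of_ne hself hsucc]
  · have hsum := Q.sum_areaForm_deformedVertex_sub (k := k) ε
    rw [hQ']
    linarith

end ReuleauxPolygon

/-! ### Vertices off the outer circle -/

theorem abs_cos_eq_cos_half_sub {x y : ℝ} (hxy : x < y) (hyx : y < x + Real.pi)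
    (h : Real.cos x = Real.cos y) : |Real.cos x| = Real.cos ((y - x) / 2) := by
  have hsin : 0 < Real.sin ((y - x) / 2) :=
    Real.sin_pos_of_pos_of_lt_pi (by linarith) (by linarith)
  have hcos : 0 < Real.cos ((y - x) / 2) := Real.cos_pos_of_mem_Ioo ⟨by linarith, by linarith⟩
  have hmid : Real.sin ((y + x) / 2) = 0 := by
    have hprod := Real.cos_sub_cos y x
    rw [h, sub_self, zero_eq_mul, mul_eq_zero] at hprod
    exact (hprod.resolve_right hsin.ne').resolve_left (by norm_num)
  have hx : Real.cos x = Real.cos ((y + x) / 2) * Real.cos ((y - x) / 2) := by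
    have hsub := Real.cos_sub ((y + x) / 2) ((y - x) / 2)
    rwa [show (y + x) / 2 - (y - x) / 2 = x by ring, hmid, zero_mul, add_zero] at hsub
  rw [hx, abs_mul, abs_of_pos hcos, Real.abs_cos_eq_sqrt_one_sub_sin_sq, hmid]
  norm_num

theorem exists_eq_neg_norm_smul_unitVec (w : ℂ) : ∃ t, w = -(‖w‖ • unitVec t) :=
  ⟨(-w).arg, by
    rw [unitVec, Complex.real_smul, ← norm_neg, Complex.norm_mul_exp_arg_mul_I, neg_neg]⟩

theorem norm_sq_neg_smul_unitVec_add (R t s : ℝ) :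
    ‖-(R • unitVec t) + unitVec s‖ ^ 2 = R ^ 2 + 1 - 2 * R * Real.cos (t - s) := by
  rw [norm_add_sq_real, norm_neg, norm_smul, norm_unitVec, norm_unitVec, inner_neg_left,
    real_inner_smul_left, inner_unitVec, mul_one, Real.norm_eq_abs, sq_abs]
  ring

theorem two_mul_norm_mul_cos_half {w : ℂ} {a b R : ℝ} (hab : a < b) (hba : b < a + Real.pi)
    (ha : ‖w + unitVec a‖ = R) (hb : ‖w + unitVec b‖ = R) (hw : w ≠ 0)
    (hR : R ^ 2 ≤ ‖w‖ ^ 2 + 1) :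
    2 * ‖w‖ * Real.cos ((b - a) / 2) = ‖w‖ ^ 2 + 1 - R ^ 2 := by
  obtain ⟨t, ht⟩ := exists_eq_neg_norm_smul_unitVec w
  have hnorm : 0 < 2 * ‖w‖ := mul_pos two_pos (norm_pos_iff.mpr hw)
  have hcos (s : ℝ) (hs : ‖w + unitVec s‖ = R) :
      2 * ‖w‖ * Real.cos (t - s) = ‖w‖ ^ 2 + 1 - R ^ 2 := by
    have hsq := norm_sq_neg_smul_unitVec_add ‖w‖ t s
    rw [← ht, hs] at hsq
    linarith
  have heq : Real.cos (t - b) = Real.cos (t - a) :=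
    mul_left_cancel₀ hnorm.ne' ((hcos b hb).trans (hcos a ha).symm)
  have hhalf := abs_cos_eq_cos_half_sub (sub_lt_sub_left hab t) (by linarith) heq
  have hnonneg : 0 ≤ Real.cos (t - b) :=
    nonneg_of_mul_nonneg_right (by rw [hcos b hb]; linarith) hnorm
  rw [sub_sub_sub_cancel_left, abs_of_nonneg hnonneg] at hhalf
  rw [← hhalf, hcos b hb]

/-- In the triangle with sides `1`, `R` and `‖w‖`, the angle opposite `R` exceeds the angle opposite
`‖w‖`, whose cosine is `c`. -/
theorem cos_half_lt {w : ℂ} {a b c R : ℝ} (hab : a < b) (hba : b < a + Real.pi)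
    (ha : ‖w + unitVec a‖ = R) (hb : ‖w + unitVec b‖ = R) (hw : w ≠ 0) (hwR : ‖w‖ < R) (hR : R ≤ 1)
    (hsum : 1 < R + ‖w‖) (hc : 2 * R * c = R ^ 2 + 1 - ‖w‖ ^ 2) :
    Real.cos ((b - a) / 2) < c := by
  have hnorm : 0 < ‖w‖ := norm_pos_iff.mpr hw
  have hcos := two_mul_norm_mul_cos_half hab hba ha hb hw (by nlinarith)
  have hgap : 0 < (R - ‖w‖) * ((R + ‖w‖) ^ 2 - 1) := mul_pos (by linarith) (by nlinarith)
  have hmul : 2 * R * ‖w‖ * Real.cos ((b - a) / 2) < 2 * R * ‖w‖ * c := by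
    linear_combination hgap + R * hcos - ‖w‖ * hc
  exact lt_of_mul_lt_mul_left hmul (mul_pos (mul_pos two_pos (hnorm.trans hwR)) hnorm).le

theorem IsUnitStar.exists_directions {N : ℕ} {P : ZMod (2 * N + 1) → ℂ}
    {α β : ZMod (2 * N + 1) → ℝ} (h : IsUnitStar P α β) (hP : Function.Injective P) (hN : 2 ≤ N)
    {k : ZMod (2 * N + 1)} {s t u : ℝ} (hs : s ∈ Set.Ioo (α (k - 2)) (β (k - 2)))
    (ht : t ∈ Set.Ioo (α k) (β k)) (hu : u ∈ Set.Ioo (α (k + 2)) (β (k + 2))) :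
    ∃ a b, a < b ∧ b < s ∧ s < a + Real.pi ∧ unitVec a = unitVec u ∧ unitVec b = unitVec t := by
  have htwo : k - 2 + (2 : ℕ) = k := by push_cast; ring
  have hfour : k - 2 + (4 : ℕ) = k + 2 := by push_cast; ring
  have hturn_two := h.unitVec_sweep (k - 2) 2 (β k - t)
  have hturn_four := h.unitVec_sweep (k - 2) 4 (β (k + 2) - u)
  rw [htwo, sub_sub_cancel, even_two.neg_one_pow, one_mul] at hturn_two
  rw [hfour, sub_sub_cancel, Even.neg_one_pow (by decide), one_mul] at hturn_four
  have hone := sweep_succ α β (k - 2) 0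
  have hthree := sweep_succ α β (k - 2) 2
  have hfive := sweep_succ α β (k - 2) 4
  rw [sweep_zero, Nat.cast_zero, add_zero] at hone
  rw [htwo] at hthree
  rw [hfour] at hfive
  have hlt_two := h.strictMono_sweep (k - 2) (show 0 + 1 < 2 by norm_num)
  have hlt_four := h.strictMono_sweep (k - 2) (show 2 + 1 < 4 by norm_num)
  have hle_pi := (h.strictMono_sweep (k - 2)).monotone (show 4 + 1 ≤ 2 * N + 1 by omega)
  rw [sweep_self, h.sum_angles hP] at hle_pi
  obtain ⟨hs₁, hs₂⟩ := hs
  obtain ⟨ht₁, ht₂⟩ := ht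
  obtain ⟨hu₁, hu₂⟩ := hu
  exact ⟨_, _, by linarith, by linarith, by linarith, hturn_four, hturn_two⟩

namespace ReuleauxPolygon

variable {N : ℕ} {r : ℝ}

theorem abs_sub_lt_half_angle (Q : ReuleauxPolygon N) (hr : HasCentredIncircle Q.body r)
    {j : ZMod (2 * N + 1)} {s t : ℝ} (hj : ‖Q.vertex j‖ ≠ 1 - r)
    (hsucc : ‖Q.vertex (j + 1)‖ = 1 - r) (hpred : ‖Q.vertex (j - 1)‖ = 1 - r)
    (hst : Q.vertex j = -((1 - r) • unitVec t) + unitVec s) (hpi : |t - s| ≤ Real.pi) :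
    |t - s| < (Q.β j - Q.α j) / 2 := by
  have hpos := Q.inradius_pos hr.1
  have hlt := (Q.norm_vertex_le hr j).lt_of_ne hj
  have hgt := Q.lt_norm_vertex hr j
  have hcos : Real.cos ((Q.β j - Q.α j) / 2) < Real.cos (t - s) := by
    refine cos_half_lt (w := Q.vertex j) (R := 1 - r) (Q.α_lt_β j) (Q.isUnitStar.lt_add_pi j)
      (by rw [← Q.vertex_succ, hsucc]) (by rw [← Q.vertex_pred, hpred])
      (norm_pos_iff.mp (hpos.trans hgt)) hlt (by linarith) (by linarith) ?_
    rw [hst, norm_sq_neg_smul_unitVec_add]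
    ring
  by_contra! hle
  have hcos_le := Real.cos_le_cos_of_nonneg_of_le_pi (by linarith [Q.α_lt_β j]) hpi hle
  rw [Real.cos_abs] at hcos_le
  exact hcos.not_ge hcos_le

theorem angle_lt_or_angle_lt (Q : ReuleauxPolygon N) (hr : HasCentredIncircle Q.body r)
    {k : ZMod (2 * N + 1)} (hk : ‖Q.vertex k‖ = 1 - r) (hsucc : ‖Q.vertex (k + 1)‖ ≠ 1 - r)
    (hsucc₂ : ‖Q.vertex (k + 2)‖ = 1 - r) (hpred : ‖Q.vertex (k - 1)‖ ≠ 1 - r)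
    (hpred₂ : ‖Q.vertex (k - 2)‖ = 1 - r) :
    Q.β k - Q.α k < Q.β (k + 1) - Q.α (k + 1) ∨ Q.β k - Q.α k < Q.β (k - 1) - Q.α (k - 1) := by
  obtain ⟨t, ⟨ht₁, ht₂⟩, hvertex⟩ := Q.exists_tangent hr hk
  have hpi := Q.isUnitStar.lt_add_pi k
  have habs_α : |t - Q.α k| = t - Q.α k := abs_of_pos (by linarith)
  have habs_β : |t - Q.β k| = Q.β k - t := by rw [abs_of_neg (by linarith), neg_sub]
  have hα := Q.abs_sub_lt_half_angle hr hsucc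
    (by rw [add_assoc, one_add_one_eq_two, hsucc₂]) (by rw [add_sub_cancel_right, hk])
    (by rw [← hvertex, Q.vertex_succ]) (by rw [habs_α]; linarith)
  have hβ := Q.abs_sub_lt_half_angle hr hpred
    (by rw [sub_add_cancel, hk]) (by rw [sub_sub, one_add_one_eq_two, hpred₂])
    (by rw [← hvertex, Q.vertex_pred]) (by rw [habs_β]; linarith)
  rw [habs_α] at hα
  rw [habs_β] at hβ
  by_contra! hle
  linarith [hle.1, hle.2]

theorem exists_cone_combination (Q : ReuleauxPolygon N) (hr : HasCentredIncircle Q.body r)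
    (hN : 2 ≤ N) {k : ZMod (2 * N + 1)} (hk : ‖Q.vertex k‖ = 1 - r)
    (hsucc₂ : ‖Q.vertex (k + 2)‖ = 1 - r) (hpred₂ : ‖Q.vertex (k - 2)‖ = 1 - r) :
    ∃ c d : ℝ, 0 < c ∧ 0 < d ∧ Q.vertex k = c • Q.vertex (k + 2) + d • Q.vertex (k - 2) := by
  obtain ⟨s, hs, hs_eq⟩ := Q.exists_tangent hr hpred₂
  obtain ⟨t, ht, ht_eq⟩ := Q.exists_tangent hr hk
  obtain ⟨u, hu, hu_eq⟩ := Q.exists_tangent hr hsucc₂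
  obtain ⟨a, b, hab, hbs, hsa, ha, hb⟩ :=
    Q.isUnitStar.exists_directions Q.vertex_injective hN hs ht hu
  have hsa_pos : 0 < Real.sin (s - a) :=
    Real.sin_pos_of_pos_of_lt_pi (by linarith) (by linarith)
  have hsb_pos : 0 < Real.sin (s - b) :=
    Real.sin_pos_of_pos_of_lt_pi (by linarith) (by linarith)
  have hba_pos : 0 < Real.sin (b - a) :=
    Real.sin_pos_of_pos_of_lt_pi (by linarith) (by linarith)
  refine ⟨_, _, div_pos hsb_pos hsa_pos, div_pos hba_pos hsa_pos, ?_⟩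
  have hcomb : unitVec b = (Real.sin (s - b) / Real.sin (s - a)) • unitVec a +
      (Real.sin (b - a) / Real.sin (s - a)) • unitVec s := by
    rw [div_eq_inv_mul, div_eq_inv_mul, mul_smul, mul_smul, ← smul_add, ← sin_sub_smul_unitVec,
      inv_smul_smul₀ hsa_pos.ne']
  rw [hs_eq, ht_eq, hu_eq, ← ha, ← hb, hcomb]
  module

theorem zero_mem_convexHull_of_ne (Q : ReuleauxPolygon N) (hr : HasCentredIncircle Q.body r)
    (hN : 2 ≤ N) {k : ZMod (2 * N + 1)} (hk : ‖Q.vertex k‖ = 1 - r)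
    (hsucc₂ : ‖Q.vertex (k + 2)‖ = 1 - r) (hpred₂ : ‖Q.vertex (k - 2)‖ = 1 - r) :
    (0 : ℂ) ∈ convexHull ℝ (Q.vertex '' {j | ‖Q.vertex j‖ = 1 - r ∧ j ≠ k}) := by
  rw [zero_mem_convexHull_iff (Set.toFinite _)]
  by_contra! hcon
  obtain ⟨v, hv⟩ := hcon
  have hinner (j) (hj : ‖Q.vertex j‖ = 1 - r) (hjk : j ≠ k) : 0 < ⟪v, Q.vertex j⟫_ℝ :=
    hv _ ⟨j, ⟨hj, hjk⟩, rfl⟩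
  obtain ⟨_, ⟨j, hj, rfl⟩, hle⟩ :=
    (zero_mem_convexHull_iff (Set.toFinite _)).mp (Q.zero_mem_convexHull hr) v
  by_cases hjk : j = k
  · obtain ⟨c, d, hc, hd, hcomb⟩ := Q.exists_cone_combination hr hN hk hsucc₂ hpred₂
    have hsucc := hinner (k + 2) hsucc₂ (Q.add_two_ne k)
    have hpred := hinner (k - 2) hpred₂ fun h => Q.add_two_ne k (by linear_combination -h)
    rw [hjk, hcomb, inner_add_right, real_inner_smul_right, real_inner_smul_right] at hle
    exact hle.not_gt (by positivity)
  · exact hle.not_gt (hinner j hj hjk)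

theorem areaForm_vertex_add_unitVec (Q : ReuleauxPolygon N) {k : ZMod (2 * N + 1)} {t : ℝ}
    (ht : Q.vertex k = -((1 - r) • unitVec t)) (s : ℝ) :
    areaForm (Q.vertex k) (Q.vertex k + unitVec s) = (1 - r) * Real.sin (t - s) := by
  rw [map_add, areaForm_self, zero_add, ht, map_neg, map_smul, neg_apply, smul_apply,
    areaForm_unitVec, smul_eq_mul, ← mul_neg, ← Real.sin_neg, neg_sub]

theorem areaForm_vertex_succ_pos_of_norm_eq (Q : ReuleauxPolygon N)
    (hr : HasCentredIncircle Q.body r) {k : ZMod (2 * N + 1)} (hk : ‖Q.vertex k‖ = 1 - r) :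
    0 < areaForm (Q.vertex k) (Q.vertex (k + 1)) := by
  obtain ⟨t, ⟨ht₁, ht₂⟩, ht⟩ := Q.exists_tangent hr hk
  rw [Q.vertex_succ, Q.areaForm_vertex_add_unitVec ht]
  exact mul_pos (by linarith [Q.lt_norm_vertex hr k, Q.inradius_pos hr.1])
    (Real.sin_pos_of_pos_of_lt_pi (by linarith) (by linarith [Q.isUnitStar.lt_add_pi k]))

theorem areaForm_vertex_pred_neg_of_norm_eq (Q : ReuleauxPolygon N)
    (hr : HasCentredIncircle Q.body r) {k : ZMod (2 * N + 1)} (hk : ‖Q.vertex k‖ = 1 - r) :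
    areaForm (Q.vertex k) (Q.vertex (k - 1)) < 0 := by
  obtain ⟨t, ⟨ht₁, ht₂⟩, ht⟩ := Q.exists_tangent hr hk
  rw [Q.vertex_pred, Q.areaForm_vertex_add_unitVec ht]
  exact mul_neg_of_pos_of_neg (by linarith [Q.lt_norm_vertex hr k, Q.inradius_pos hr.1])
    (Real.sin_neg_of_neg_of_neg_pi_lt (by linarith) (by linarith [Q.isUnitStar.lt_add_pi k]))

theorem angleGap_eq (Q : ReuleauxPolygon N) (k : ZMod (2 * N + 1)) :
    IsLinkage.angleGap (Q.vertex (k - 1)) (Q.vertex (k + 2)) (Q.movedVertex k) (Q.movedSucc k) 0 =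
      Real.cos (Q.β (k + 1) - Q.α (k + 1)) - Real.cos (Q.β k - Q.α k) := by
  have hleft : Q.vertex k - Q.vertex (k - 1) = -unitVec (Q.β k) := by
    rw [Q.vertex_pred, sub_add_cancel_left]
  have hmid : Q.vertex (k + 1) - Q.vertex k = unitVec (Q.α k) := by
    rw [Q.vertex_succ, add_sub_cancel_left]
  have hright : Q.vertex (k + 1) - Q.vertex (k + 2) = -unitVec (Q.α (k + 1)) := by
    rw [show k + 2 = k + 1 + 1 by ring, Q.vertex_succ (k + 1), sub_add_cancel_left]
  have hα : unitVec (Q.α k) = -unitVec (Q.β (k + 1)) := by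
    rw [Q.isUnitStar.unitVec_β_succ, neg_neg]
  rw [IsLinkage.angleGap, movedVertex_zero, movedSucc_zero, hleft, hmid, hright, inner_add_right,
    inner_neg_right, inner_unitVec, hα, inner_neg_neg, inner_unitVec, ← Real.cos_neg (Q.α k - _),
    neg_sub]
  ring

theorem angleGap_neg (Q : ReuleauxPolygon N) {k : ZMod (2 * N + 1)}
    (h : Q.β k - Q.α k < Q.β (k + 1) - Q.α (k + 1)) :
    IsLinkage.angleGap (Q.vertex (k - 1)) (Q.vertex (k + 2)) (Q.movedVertex k)
      (Q.movedSucc k) 0 < 0 := by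
  rw [angleGap_eq, sub_neg]
  exact Real.cos_lt_cos_of_nonneg_of_le_pi (by linarith [Q.α_lt_β k])
    (by linarith [Q.isUnitStar.lt_add_pi (k + 1)]) h

theorem angleGap_pos (Q : ReuleauxPolygon N) {k : ZMod (2 * N + 1)}
    (h : Q.β (k + 1) - Q.α (k + 1) < Q.β k - Q.α k) :
    0 < IsLinkage.angleGap (Q.vertex (k - 1)) (Q.vertex (k + 2)) (Q.movedVertex k)
      (Q.movedSucc k) 0 := by
  rw [angleGap_eq, sub_pos]
  exact Real.cos_lt_cos_of_nonneg_of_le_pi (by linarith [Q.α_lt_β (k + 1)])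
    (by linarith [Q.isUnitStar.lt_add_pi k]) h

theorem norm_movedSucc_zero_sub_lt (Q : ReuleauxPolygon N) (hN : 2 ≤ N) (k : ZMod (2 * N + 1)) :
    ‖Q.movedSucc k 0 - Q.vertex (k - 1)‖ < 1 := by
  have hthree : (3 : ZMod (2 * N + 1)) ≠ 0 := by
    exact_mod_cast zmod_natCast_ne_zero three_pos (by omega : 3 < 2 * N + 1)
  rw [movedSucc_zero]
  exact Q.norm_vertex_sub_lt_one (fun h => Q.add_one_ne k (by rw [h, sub_add_cancel]))
    fun h => hthree (by linear_combination -h)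

open Filter Topology

theorem eventually_norm_movedVertex_le (Q : ReuleauxPolygon N) (hr : HasCentredIncircle Q.body r)
    {k : ZMod (2 * N + 1)} (hk : ‖Q.vertex k‖ ≠ 1 - r) :
    ∀ᶠ ε in 𝓝 (0 : ℝ), ‖Q.movedVertex k ε‖ ≤ 1 - r := by
  refine ((Q.isLinkage k).continuousAt_left.norm.eventually_lt_const ?_).mono fun _ => le_of_lt
  simpa only [movedVertex_zero] using (Q.norm_vertex_le hr k).lt_of_ne hk

theorem eventually_norm_movedSucc_le (Q : ReuleauxPolygon N) (hr : HasCentredIncircle Q.body r)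
    {k : ZMod (2 * N + 1)} (hk : ‖Q.vertex (k + 1)‖ ≠ 1 - r) :
    ∀ᶠ ε in 𝓝 (0 : ℝ), ‖Q.movedSucc k ε‖ ≤ 1 - r := by
  refine ((Q.isLinkage k).continuousAt_right.norm.eventually_lt_const ?_).mono fun _ => le_of_lt
  simpa only [movedSucc_zero] using (Q.norm_vertex_le hr (k + 1)).lt_of_ne hk

theorem not_isRigid_of_consecutive (Q : ReuleauxPolygon N) (hr : HasCentredIncircle Q.body r)
    (hN : 2 ≤ N) {k : ZMod (2 * N + 1)} (hk : ‖Q.vertex k‖ ≠ 1 - r)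
    (hsucc : ‖Q.vertex (k + 1)‖ ≠ 1 - r) : ¬ Q.IsRigid r := by
  have hx := Q.eventually_norm_movedVertex_le hr hk
  have hy := Q.eventually_norm_movedSucc_le hr hsucc
  have hlt := Q.norm_movedSucc_zero_sub_lt hN k
  have hzero : (0 : ℂ) ∈ convexHull ℝ
      (Q.vertex '' {j | ‖Q.vertex j‖ = 1 - r ∧ j ≠ k ∧ j ≠ k + 1}) := by
    refine convexHull_mono (Set.image_mono ?_) (Q.zero_mem_convexHull hr)
    exact fun j hj => ⟨hj, fun h => hk (h ▸ hj), fun h => hsucc (h ▸ hj)⟩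
  rcases le_total (IsLinkage.angleGap (Q.vertex (k - 1)) (Q.vertex (k + 2)) (Q.movedVertex k)
    (Q.movedSucc k) 0) 0 with hgap | hgap
  · exact Q.not_isRigid_of_eventually_lt_crossSum hr (nhdsWithin_le_nhds (s := Set.Ioi 0))
      (hx.filter_mono nhdsWithin_le_nhds) (hy.filter_mono nhdsWithin_le_nhds)
      ((Q.isLinkage k).eventually_crossSum_lt_right hgap hlt) hzero
  · exact Q.not_isRigid_of_eventually_lt_crossSum hr (nhdsWithin_le_nhds (s := Set.Iio 0))
      (hx.filter_mono nhdsWithin_le_nhds) (hy.filter_mono nhdsWithin_le_nhds)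
      ((Q.isLinkage k).eventually_crossSum_lt_left hgap hlt) hzero

theorem not_isRigid_of_angle_lt_succ (Q : ReuleauxPolygon N) (hr : HasCentredIncircle Q.body r)
    (hN : 2 ≤ N) {k : ZMod (2 * N + 1)} (hk : ‖Q.vertex k‖ = 1 - r)
    (hsucc : ‖Q.vertex (k + 1)‖ ≠ 1 - r) (hsucc₂ : ‖Q.vertex (k + 2)‖ = 1 - r)
    (hpred₂ : ‖Q.vertex (k - 2)‖ = 1 - r)
    (hangle : Q.β k - Q.α k < Q.β (k + 1) - Q.α (k + 1)) : ¬ Q.IsRigid r := by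
  have hx : ∀ᶠ ε in 𝓝[>] (0 : ℝ), ‖Q.movedVertex k ε‖ ≤ 1 - r := by
    refine ((Q.isLinkage k).eventually_norm_left_lt ?_).mono fun ε h => ?_
    · rw [movedVertex_zero]
      exact Q.areaForm_vertex_pred_neg_of_norm_eq hr hk
    · rw [movedVertex_zero, hk] at h
      exact h.le
  refine Q.not_isRigid_of_eventually_lt_crossSum hr nhdsWithin_le_nhds hx
    ((Q.eventually_norm_movedSucc_le hr hsucc).filter_mono nhdsWithin_le_nhds)
    ((Q.isLinkage k).eventually_crossSum_lt_right (Q.angleGap_neg hangle).le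
      (Q.norm_movedSucc_zero_sub_lt hN k))
    (convexHull_mono (Set.image_mono ?_) (Q.zero_mem_convexHull_of_ne hr hN hk hsucc₂ hpred₂))
  exact fun j ⟨hj, hjk⟩ => ⟨hj, hjk, fun h => hsucc (h ▸ hj)⟩

theorem not_isRigid_of_angle_lt_pred (Q : ReuleauxPolygon N) (hr : HasCentredIncircle Q.body r)
    (hN : 2 ≤ N) {k : ZMod (2 * N + 1)} (hk : ‖Q.vertex (k + 1)‖ = 1 - r)
    (hpred : ‖Q.vertex k‖ ≠ 1 - r) (hsucc₂ : ‖Q.vertex (k + 1 + 2)‖ = 1 - r)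
    (hpred₂ : ‖Q.vertex (k + 1 - 2)‖ = 1 - r)
    (hangle : Q.β (k + 1) - Q.α (k + 1) < Q.β k - Q.α k) : ¬ Q.IsRigid r := by
  have hy : ∀ᶠ ε in 𝓝[<] (0 : ℝ), ‖Q.movedSucc k ε‖ ≤ 1 - r := by
    refine ((Q.isLinkage k).eventually_norm_right_lt ?_).mono fun ε h => ?_
    · rw [movedSucc_zero, show k + 2 = k + 1 + 1 by ring]
      exact Q.areaForm_vertex_succ_pos_of_norm_eq hr hk
    · rw [movedSucc_zero, hk] at h
      exact h.le
  refine Q.not_isRigid_of_eventually_lt_crossSum hr nhdsWithin_le_nhds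
    ((Q.eventually_norm_movedVertex_le hr hpred).filter_mono nhdsWithin_le_nhds) hy
    ((Q.isLinkage k).eventually_crossSum_lt_left (Q.angleGap_pos hangle).le
      (Q.norm_movedSucc_zero_sub_lt hN k))
    (convexHull_mono (Set.image_mono ?_) (Q.zero_mem_convexHull_of_ne hr hN hk hsucc₂ hpred₂))
  exact fun j ⟨hj, hjk⟩ => ⟨hj, fun h => hpred (h ▸ hj), hjk⟩

theorem not_isRigid_of_alternating (Q : ReuleauxPolygon N) (hr : HasCentredIncircle Q.body r)
    (hN : 2 ≤ N) {k : ZMod (2 * N + 1)} (hsucc : ‖Q.vertex (k + 1)‖ ≠ 1 - r)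
    (hpred : ‖Q.vertex (k - 1)‖ ≠ 1 - r) : ¬ Q.IsRigid r := by
  intro hQ
  have hconsecutive (j) (hj : ‖Q.vertex j‖ ≠ 1 - r) : ‖Q.vertex (j + 1)‖ = 1 - r :=
    not_not.mp fun h => Q.not_isRigid_of_consecutive hr hN hj h hQ
  have hk : ‖Q.vertex k‖ = 1 - r := sub_add_cancel k 1 ▸ hconsecutive _ hpred
  have hsucc₂ : ‖Q.vertex (k + 2)‖ = 1 - r := by
    rw [show k + 2 = k + 1 + 1 by ring]
    exact hconsecutive _ hsucc
  have hpred₂ : ‖Q.vertex (k - 2)‖ = 1 - r := by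
    by_contra h
    exact hpred (by rw [show k - 1 = k - 2 + 1 by ring]; exact hconsecutive _ h)
  rcases Q.angle_lt_or_angle_lt hr hk hsucc hsucc₂ hpred hpred₂ with hangle | hangle
  · exact Q.not_isRigid_of_angle_lt_succ hr hN hk hsucc hsucc₂ hpred₂ hangle hQ
  · obtain ⟨i, rfl⟩ : ∃ i, k = i + 1 := ⟨k - 1, by ring⟩
    rw [add_sub_cancel_right] at hpred hangle
    exact Q.not_isRigid_of_angle_lt_pred hr hN hk hpred hsucc₂ hpred₂ hangle hQ

theorem norm_vertex_of_triangle (Q : ReuleauxPolygon 1) (hr : HasCentredIncircle Q.body r)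
    (k : ZMod (2 * 1 + 1)) : ‖Q.vertex k‖ = 1 - r := by
  by_contra hk
  have hlt := (Q.norm_vertex_le hr k).lt_of_ne hk
  have hadj : ∀ i j : ZMod 3, i ≠ j → i = j + 1 ∨ j = i + 1 := by decide
  have hside (i j) (hij : i ≠ j) :
      1 = ‖Q.vertex i‖ ^ 2 - 2 * ⟪Q.vertex i, Q.vertex j⟫_ℝ + ‖Q.vertex j‖ ^ 2 := by
    rw [← norm_sub_sq_real]
    rcases hadj i j hij with h | h
    · rw [h, Q.norm_vertex_succ_sub, one_pow]
    · rw [h, norm_sub_rev, Q.norm_vertex_succ_sub, one_pow]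
  have hexists := (zero_mem_convexHull_iff (Set.toFinite _)).mp (Q.zero_mem_convexHull hr)
  obtain ⟨_, ⟨i, hi, rfl⟩, hki_inner⟩ := hexists (-Q.vertex k)
  obtain ⟨_, ⟨j, hj, rfl⟩, hij_inner⟩ := hexists (Q.vertex i)
  rw [Set.mem_ofPred_eq] at hi hj
  have hR : 0 < 1 - r := (norm_nonneg _).trans_lt hlt
  have hki : k ≠ i := fun h => hk (h ▸ hi)
  have hij : i ≠ j := by
    rintro rfl
    rw [real_inner_self_eq_norm_sq, hi] at hij_inner
    exact hij_inner.not_gt (by positivity)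
  have hki_side := hside k i hki
  have hij_side := hside i j hij
  rw [inner_neg_left] at hki_inner
  rw [hi] at hki_side hij_side
  rw [hj] at hij_side
  have hsq : ‖Q.vertex k‖ ^ 2 < (1 - r) ^ 2 := pow_lt_pow_left₀ hlt (norm_nonneg _) two_ne_zero
  linarith

theorem two_le_of_norm_vertex_ne (Q : ReuleauxPolygon N) (hr : HasCentredIncircle Q.body r)
    {k : ZMod (2 * N + 1)} (hk : ‖Q.vertex k‖ ≠ 1 - r) : 2 ≤ N := by
  by_contra! hN
  obtain rfl : N = 1 := by linarith [Q.three_le]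
  exact hk (Q.norm_vertex_of_triangle hr k)

theorem IsRigid.norm_vertex_eq_of_norm_ne {Q : ReuleauxPolygon N} (hQ : Q.IsRigid r)
    (hr : HasCentredIncircle Q.body r) {k : ZMod (2 * N + 1)} (hk : ‖Q.vertex k‖ ≠ 1 - r) :
    ∀ j ∈ ({k - 2, k - 1, k + 1, k + 2} : Set (ZMod (2 * N + 1))), ‖Q.vertex j‖ = 1 - r := by
  have hN := Q.two_le_of_norm_vertex_ne hr hk
  rintro j (rfl | rfl | rfl | rfl) <;> by_contra hj
  · exact Q.not_isRigid_of_alternating hr hN (k := k - 1) (by rwa [sub_add_cancel])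
      (by rwa [sub_sub, one_add_one_eq_two]) hQ
  · exact Q.not_isRigid_of_consecutive hr hN hj (by rwa [sub_add_cancel]) hQ
  · exact Q.not_isRigid_of_consecutive hr hN hk hj hQ
  · exact Q.not_isRigid_of_alternating hr hN (k := k + 1)
      (by rwa [add_assoc, one_add_one_eq_two]) (by rwa [add_sub_cancel_right]) hQ

theorem IsRigid.isCluster {Q : ReuleauxPolygon N} (hQ : Q.IsRigid r)
    (hr : HasCentredIncircle Q.body r) {k : ZMod (2 * N + 1)} (hk : ‖Q.vertex k‖ ≠ 1 - r) :
    Q.IsCluster r k := by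
  have hnear := hQ.norm_vertex_eq_of_norm_ne hr hk
  exact ⟨Q.isTangentArc hr (hnear _ (by simp)), Q.isTangentArc hr (hnear _ (by simp)),
    Q.lt_norm_vertex hr k, (Q.norm_vertex_le hr k).lt_of_ne hk, hnear _ (by simp),
    hnear _ (by simp)⟩

end ReuleauxPolygon

theorem eq_or_of_not_disjoint_labelTriple {n : ℕ} {i j : ZMod n}
    (h : ¬ Disjoint (labelTriple i) (labelTriple j)) :
    j = i ∨ j ∈ ({i - 2, i - 1, i + 1, i + 2} : Set (ZMod n)) := by
  obtain ⟨m, hi, hj⟩ := Finset.not_disjoint_iff.mp h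
  simp only [labelTriple, Finset.mem_insert, Finset.mem_singleton] at hi hj
  simp only [Set.mem_insert_iff, Set.mem_singleton_iff]
  grind

theorem proposition3p4 {N : ℕ} {r : ℝ} (Q : ReuleauxPolygon N)
    (hr : HasCentredIncircle Q.body r) (hQ : Q.IsRigid r) :
    ∃ C E : Finset (ZMod (2 * N + 1)),
      (∀ k ∈ C, Q.IsCluster r k) ∧
      (∀ k ∈ E, Q.IsExtremalArc r k) ∧
      (C : Set (ZMod (2 * N + 1))).PairwiseDisjoint labelTriple ∧
      Disjoint E (C.biUnion labelTriple) ∧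
      E ∪ C.biUnion labelTriple = Finset.univ := by
  classical
  set C : Finset (ZMod (2 * N + 1)) := {k | ‖Q.vertex k‖ ≠ 1 - r}
  have hC (k) : k ∈ C ↔ ‖Q.vertex k‖ ≠ 1 - r := Finset.mem_filter_univ k
  refine ⟨C, (C.biUnion labelTriple)ᶜ, fun k hk => hQ.isCluster hr ((hC k).mp hk), fun k hk => ?_,
    fun i hi j hj hij => ?_, disjoint_compl_left, by rw [Finset.union_comm, Finset.union_compl]⟩
  · have houter (j) (hj : k ∈ labelTriple j) : ‖Q.vertex j‖ = 1 - r := by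
      by_contra hne
      exact Finset.mem_compl.mp hk (Finset.mem_biUnion.mpr ⟨j, (hC j).mpr hne, hj⟩)
    exact ⟨Q.isTangentArc hr (houter k (by simp [labelTriple])),
      houter (k + 1) (by simp [labelTriple]), houter (k - 1) (by simp [labelTriple])⟩
  · by_contra hdisjoint
    rcases eq_or_of_not_disjoint_labelTriple hdisjoint with rfl | hj'
    · exact hij rfl
    · exact (hC j).mp hj (hQ.norm_vertex_eq_of_norm_ne hr ((hC i).mp hi) j hj')
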